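/- Let $n\ge 3$, let $\mathbb{B}^n$ be the open unit ball of $\mathbb{R}^n$ with the Euclidean norm $|\cdot|$. A function $u\in C^2(\mathbb{B}^n,\mathbb{R})$ is called harmonic if $\Delta u=0$ on $\mathbb{B}^n$, and hyperbolic harmonic if $$(1-|x|^2)^2\,\Delta u(x)+2(n-2)(1-|x|^2)\sum_{i=1}^n x_i\frac{\partial u}{\partial x_i}(x)=0\qquad\text{for all }x\in\mathbb{B}^n .$$ Let $h:\mathbb{B}^n\to(-1,1)$. 1. If $h$ is harmonic, then $|\nabla h(0)|\le \frac n2\,(1-|h(0)|^2)$. 2. If $h$ is hyperbolic harmonic, then $|\nabla h(0)|\le (n-1)\,(1-|h(0)|^2)$. If $n\ge 4$, both inequalities are strict for every such $h$. For every $n\ge 3$ the constants are sharp: for every real $c<\frac n2$ there is a harmonic $h:\mathbb{B}^n\to(-1,1)$ with $|\nabla h(0)|>c\,(1-|h(0)|^2)$, and for every real $c<n-1$ there is a hyperbolic harmonic $h:\mathbb{B}^n\to(-1,1)$ with $|\nabla h(0)|>c\,(1-|h(0)|^2)$. -/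

import Mathlib

/-- The open unit ball of `ℝⁿ` with the Euclidean norm. -/
def unitBall (n : ℕ) : Set (EuclideanSpace ℝ (Fin n)) := Metric.ball 0 1

/-- The hyperbolic Laplacian
`Δ_h u(x) = (1 - |x|²)² Δu(x) + 2 (n - 2) (1 - |x|²) ∑ᵢ xᵢ ∂u/∂xᵢ(x)`. -/
noncomputable def hyperbolicLaplacian {n : ℕ} (u : EuclideanSpace ℝ (Fin n) → ℝ)
    (x : EuclideanSpace ℝ (Fin n)) : ℝ :=
  (1 - ‖x‖ ^ 2) ^ 2 * Laplacian.laplacian u x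
    + 2 * ((n : ℝ) - 2) * (1 - ‖x‖ ^ 2) *
      ∑ i : Fin n, x i * fderiv ℝ u x (EuclideanSpace.single i (1 : ℝ))

/-- `u` is `C²` and hyperbolic harmonic on the open unit ball (the values of `u` outside the ball
play no role). -/
def IsHyperbolicHarmonic {n : ℕ} (u : EuclideanSpace ℝ (Fin n) → ℝ) : Prop :=
  ContDiffOn ℝ 2 u (unitBall n) ∧ ∀ x ∈ unitBall n, hyperbolicLaplacian u x = 0

/-- `u` is `C²` and harmonic on the open unit ball (the values of `u` outside the ball
play no role). -/
def IsHarmonic {n : ℕ} (u : EuclideanSpace ℝ (Fin n) → ℝ) : Prop :=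
  InnerProductSpace.HarmonicOnNhd u (unitBall n)

open MeasureTheory Metric Set Filter Topology InnerProductSpace

/-! ### Rotation invariance and integration by parts on the unit sphere. -/

section SphereMeasure

/-! Both equations are cases of `(1 - |x|²) Δh + 2β x·∇h = 0`, with `β = 0` or `β = n - 2`. Let `a =
h 0`, let `e` be a unit vector along the gradient at `0`, and let `k(r)` be the integral of `h(rζ)
⟪e, ζ⟫` over the unit sphere with normalized measure.

The spherical means of `h` all equal `a` (`IsWeightedHarmonic.mean_value`). Since `|h| < 1`, for
every `t` this gives `k(r) ≤ ∫ |⟪e, ζ⟫ - t| + t a`. The key estimate is `∫ |⟪e, ζ⟫ - t| ≤ (1 + t²) /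
2`. For `n = 3` it is an equality, because heights on the sphere are uniform on `[-1, 1]`
(Archimedes). In general, integration by parts on the sphere (`integral_sphere_stein`), applied to a
solution `f` of `(1 - x²) f' - 2 x f = |x - t| - (1 + t²) / 2`, shows that the defect is `(n - 3) ∫
x f(x)` with `x = ⟪e, ζ⟫`. This integral is negative because the odd part of `f` has sign opposite
to `x`. With `t = -a` one gets `k ≤ M` for some `M ≤ (1 - a²) / 2`, strictly for `n ≥ 4`. As `M`
does not depend on `r`, strictness survives the limit `r → 1`.

The gradient is recovered from `k`. In the harmonic case `k(r) = r ∂ₑh(0) / n`. In the hyperbolic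
case a conserved quantity gives `(1 - r²) r k' = ∂ₑh(0) r - (n - 1)(1 + r²) k`, and a value of
`∂ₑh(0)` above `2 (n - 1) M` would force `k` to diverge logarithmically at `r = 1`.

For sharpness, take a bounded positive solution `u` with `∂ₑu(0) ≥ 2 c u(0)` and rescale it to `h =
-1 + u / B`; then `1 - h(0)² < 2 u(0) / B` (`IsWeightedHarmonic.exists_gradient_gt`). In the
harmonic case `u` is a Poisson kernel with pole slightly outside the ball. In the hyperbolic case it
is a function of the distance to a hyperbolic hyperplane that recedes to the boundary. -/

theorem norm_sphere_coe {E : Type*} [NormedAddCommGroup E] (ζ : sphere (0 : E) 1) :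
    ‖(ζ : E)‖ = 1 := by
  simp

variable {E : Type*} [NormedAddCommGroup E] [InnerProductSpace ℝ E] [FiniteDimensional ℝ E]
  [MeasurableSpace E] [BorelSpace E]

variable (E) in
/-- The normalized surface measure on the unit sphere. -/
noncomputable def sphereMeasure : Measure (sphere (0 : E) 1) :=
  ((volume : Measure E).toSphere univ)⁻¹ • (volume : Measure E).toSphere

instance [Nontrivial E] : IsProbabilityMeasure (sphereMeasure E) where
  measure_univ := by
    rw [sphereMeasure, Measure.smul_apply, smul_eq_mul]
    refine ENNReal.inv_mul_cancel ?_ (measure_ne_top _ _)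
    rw [Ne, Measure.measure_univ_eq_zero]
    exact Measure.toSphere_ne_zero (volume : Measure E)

/-- A linear isometry equivalence, restricted to the unit sphere. -/
def sphereHomeomorph (L : E ≃ₗᵢ[ℝ] E) : sphere (0 : E) 1 ≃ₜ sphere (0 : E) 1 where
  toFun ζ := ⟨L ζ, by simp⟩
  invFun ζ := ⟨L.symm ζ, by simp⟩
  left_inv ζ := by simp
  right_inv ζ := by simp
  continuous_toFun := by fun_prop
  continuous_invFun := by fun_prop

/-- The surface measure of a set is, up to a constant, the volume of the cone over it, and a linear
isometry carries cones to cones and preserves volume. -/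
theorem measurePreserving_sphereHomeomorph (L : E ≃ₗᵢ[ℝ] E) :
    MeasurePreserving (sphereHomeomorph L) (sphereMeasure E) (sphereMeasure E) := by
  refine ⟨(sphereHomeomorph L).continuous.measurable, ?_⟩
  ext s hs
  rw [Measure.map_apply (sphereHomeomorph L).continuous.measurable hs]
  simp only [sphereMeasure, Measure.smul_apply]
  rw [Measure.toSphere_apply' _ hs,
    Measure.toSphere_apply' _ ((sphereHomeomorph L).continuous.measurable hs),
    ← L.symm.measurePreserving.measure_preimage_equiv (f := L.symm.toHomeomorph.toMeasurableEquiv)]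
  congr 3
  ext x
  simp only [Set.mem_smul, Set.mem_image, mem_preimage]
  constructor
  · rintro ⟨r, hr, y, ⟨ζ, hζ, rfl⟩, h⟩
    refine ⟨r, hr, L ζ, ⟨_, hζ, rfl⟩, ?_⟩
    rw [← map_smul, h]
    exact L.apply_symm_apply x
  · rintro ⟨r, hr, y, ⟨ζ, hζ, rfl⟩, rfl⟩
    refine ⟨r, hr, L.symm ζ, ⟨(sphereHomeomorph L).symm ζ, by simpa using hζ, rfl⟩, ?_⟩
    rw [← map_smul]
    rfl

theorem integral_sphere_comp_isometry (L : E ≃ₗᵢ[ℝ] E) (F : E → ℝ) :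
    ∫ ζ, F (L (ζ : E)) ∂(sphereMeasure E) = ∫ ζ, F (ζ : E) ∂(sphereMeasure E) :=
  (measurePreserving_sphereHomeomorph L).integral_comp
    (sphereHomeomorph L).measurableEmbedding (fun ζ : sphere (0 : E) 1 => F ζ)

theorem Continuous.integrable_sphere [Nontrivial E] {f : sphere (0 : E) 1 → ℝ}
    (hf : Continuous f) :
    Integrable f (sphereMeasure E) :=
  hf.integrable_of_hasCompactSupport (HasCompactSupport.of_compactSpace f)

/-- Differentiation under the integral over the unit sphere. -/
theorem hasDerivAt_integral_sphere [Nontrivial E] {g g' : ℝ → sphere (0 : E) 1 → ℝ} {s : Set ℝ}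
    (hs : IsOpen s) (hg : ∀ r ∈ s, Continuous (g r))
    (hd : ∀ r ∈ s, ∀ ζ, HasDerivAt (fun t => g t ζ) (g' r ζ) r)
    (hg' : ContinuousOn (fun p : ℝ × sphere (0 : E) 1 => g' p.1 p.2) (s ×ˢ univ))
    {r : ℝ} (hr : r ∈ s) :
    HasDerivAt (fun t => ∫ ζ, g t ζ ∂(sphereMeasure E)) (∫ ζ, g' r ζ ∂(sphereMeasure E)) r := by
  obtain ⟨ε, hε, hεs⟩ := Metric.nhds_basis_closedBall.mem_iff.1 (hs.mem_nhds hr)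
  obtain ⟨C, hC⟩ := ((isCompact_closedBall r ε).prod
    (isCompact_univ (X := sphere (0 : E) 1))).exists_bound_of_continuousOn
    (hg'.mono (prod_mono hεs Subset.rfl))
  have hc : Continuous (g' r) := by
    have : Continuous fun ζ : sphere (0 : E) 1 => g' (r, ζ).1 (r, ζ).2 :=
      hg'.comp_continuous (by fun_prop) (fun ζ => ⟨hr, mem_univ _⟩)
    exact this
  refine (hasDerivAt_integral_of_dominated_loc_of_deriv_le (bound := fun _ => C)
    (closedBall_mem_nhds r hε) ?_ (hg r hr).integrable_sphere
    hc.integrable_sphere.aestronglyMeasurable ?_ (integrable_const _) ?_).2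
  · filter_upwards [hs.mem_nhds hr] with t ht
    exact (hg t ht).integrable_sphere.aestronglyMeasurable
  · exact Eventually.of_forall fun ζ t ht => hC (t, ζ) ⟨ht, mem_univ _⟩
  · exact Eventually.of_forall fun ζ t ht => hd t (hεs ht) ζ

/-- Reflections `R θ` in the lines spanned by `cos θ u + sin θ w` form a curve of isometries, so `∫
F (R θ ζ)` is constant in `θ`; its derivative at `θ = 0` is the claim. -/
theorem integral_sphere_rotation_of_orthonormal [Nontrivial E] {F : E → ℝ} {F' : E → E →L[ℝ] ℝ}
    (hF : ∀ ζ ∈ sphere (0 : E) 1, HasFDerivAt F (F' ζ) ζ)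
    (hF' : ContinuousOn F' (sphere (0 : E) 1)) {u w : E} (hu : ‖u‖ = 1) (hw : ‖w‖ = 1)
    (huw : ⟪u, w⟫_ℝ = 0) :
    ∫ ζ, F' (ζ : E) (⟪u, (ζ : E)⟫_ℝ • w - ⟪w, (ζ : E)⟫_ℝ • u) ∂(sphereMeasure E) = 0 := by
  set v : ℝ → E := fun θ => Real.cos θ • u + Real.sin θ • w with hv
  set v' : ℝ → E := fun θ => (-Real.sin θ) • u + Real.cos θ • w with hv'
  have hvn : ∀ θ, ‖v θ‖ = 1 := by
    intro θ
    have : ‖v θ‖ ^ 2 = 1 := by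
      rw [hv, norm_add_sq_real, norm_smul, norm_smul, inner_smul_left, inner_smul_right, huw, hu,
        hw]
      simp [Real.cos_sq_add_sin_sq]
    nlinarith [norm_nonneg (v θ)]
  set R : ℝ → E ≃ₗᵢ[ℝ] E := fun θ => (ℝ ∙ v θ).reflection with hR
  have hRapp : ∀ θ x, R θ x = (2 * ⟪v θ, x⟫_ℝ) • v θ - x := by
    intro θ x
    rw [hR]
    simp only [Submodule.reflection_singleton_apply, hvn]
    simp [two_smul, two_mul, add_smul]
  set R' : ℝ → E → E := fun θ x => (2 * ⟪v θ, x⟫_ℝ) • v' θ + (2 * ⟪v' θ, x⟫_ℝ) • v θ with hR'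
  have hvd : ∀ θ, HasDerivAt v (v' θ) θ := fun θ =>
    ((Real.hasDerivAt_cos θ).smul_const u).add ((Real.hasDerivAt_sin θ).smul_const w)
  have hvc : Continuous v := by fun_prop
  have hv'c : Continuous v' := by fun_prop
  have hRd : ∀ x θ, HasDerivAt (fun θ => R θ x) (R' θ x) θ := by
    intro x θ
    simp only [hRapp]
    have h1 := (((hvd θ).inner ℝ (hasDerivAt_const θ x)).const_mul 2).smul (hvd θ)
    simpa [hR'] using h1.sub_const x
  have hmem : ∀ θ (ζ : sphere (0 : E) 1), R θ ζ ∈ sphere (0 : E) 1 := by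
    intro θ ζ; simp
  have key := hasDerivAt_integral_sphere (E := E) (s := univ) isOpen_univ
    (g := fun θ ζ => F (R θ ζ)) (g' := fun θ ζ => F' (R θ ζ) (R' θ ζ)) (r := 0)
    (fun θ _ => by
      have hFc : ContinuousOn F (sphere (0 : E) 1) :=
        fun x hx => (hF x hx).continuousAt.continuousWithinAt
      exact hFc.comp_continuous (by fun_prop) (fun ζ => hmem θ ζ))
    (fun θ _ ζ => (hF _ (hmem θ ζ)).comp_hasDerivAt θ (hRd ζ θ))
    (by
      have h1 : Continuous fun p : ℝ × sphere (0 : E) 1 => F' (R p.1 p.2) := by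
        refine hF'.comp_continuous ?_ (fun p => hmem p.1 p.2)
        simp only [hRapp]
        fun_prop
      have h2 : Continuous fun p : ℝ × sphere (0 : E) 1 => R' p.1 p.2 := by
        simp only [hR']
        fun_prop
      exact (h1.clm_apply h2).continuousOn)
    (mem_univ _)
  simp only [integral_sphere_comp_isometry] at key
  have h0 := key.unique (hasDerivAt_const _ _)
  -- `R 0` is not the identity, so the velocity is rewritten as twice the rotation field at the
  -- point `R 0 x`; invariance under `R 0` then removes the reflection.
  have h1 : ∀ x : E, R' 0 x = 2 • (⟪u, R 0 x⟫_ℝ • w - ⟪w, R 0 x⟫_ℝ • u) := by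
    intro x
    have hwu : ⟪w, u⟫_ℝ = 0 := by rw [real_inner_comm]; exact huw
    rw [hRapp]
    simp only [hR', hv, hv', Real.cos_zero, Real.sin_zero, one_smul, zero_smul, add_zero, neg_zero,
      zero_add, inner_sub_right, inner_smul_right, hwu, real_inner_self_eq_norm_sq, hu]
    module
  simp only [h1] at h0
  have h2 := integral_sphere_comp_isometry (R 0)
    (fun x => F' x (2 • (⟪u, x⟫_ℝ • w - ⟪w, x⟫_ℝ • u)))
  rw [h2] at h0
  simp only [map_nsmul, nsmul_eq_mul] at h0
  rw [integral_const_mul] at h0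
  simpa using h0

/-- The generator of the rotations in the plane of `u` and `w` integrates to zero over the unit
sphere. -/
theorem integral_sphere_rotation [Nontrivial E] {F : E → ℝ} {F' : E → E →L[ℝ] ℝ}
    (hF : ∀ ζ ∈ sphere (0 : E) 1, HasFDerivAt F (F' ζ) ζ)
    (hF' : ContinuousOn F' (sphere (0 : E) 1)) (u w : E) :
    ∫ ζ, F' (ζ : E) (⟪u, (ζ : E)⟫_ℝ • w - ⟪w, (ζ : E)⟫_ℝ • u) ∂(sphereMeasure E) = 0 := by
  by_cases hu : u = 0
  · simp [hu]
  -- Gram–Schmidt: the field is alternating and bilinear in `(u, w)`, so the component of `w` along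
  -- `u` drops out and normalization only contributes a scalar.
  set c : ℝ := ⟪u, w⟫_ℝ / ‖u‖ ^ 2 with hc
  have hu' : ‖u‖ ≠ 0 := by simpa using hu
  set z : E := w - c • u with hz
  have hw : w = z + c • u := by simp [hz]
  have hrew : ∀ x : E, ⟪u, x⟫_ℝ • w - ⟪w, x⟫_ℝ • u = ⟪u, x⟫_ℝ • z - ⟪z, x⟫_ℝ • u := by
    intro x
    rw [hw, inner_add_left, inner_smul_left]
    simp
    module
  simp only [hrew]
  by_cases hz0 : z = 0
  · simp [hz0]
  have hz' : ‖z‖ ≠ 0 := by simpa using hz0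
  have hort : ⟪u, z⟫_ℝ = 0 := by
    rw [hz, inner_sub_right, inner_smul_right, real_inner_self_eq_norm_sq, hc]
    field_simp
    ring
  have h := integral_sphere_rotation_of_orthonormal hF hF' (u := ‖u‖⁻¹ • u) (w := ‖z‖⁻¹ • z)
    (by rw [norm_smul, norm_inv, norm_norm, inv_mul_cancel₀ hu'])
    (by rw [norm_smul, norm_inv, norm_norm, inv_mul_cancel₀ hz'])
    (by rw [inner_smul_left, inner_smul_right, hort]; simp)
  have h2 : ∀ x : E, ⟪‖u‖⁻¹ • u, x⟫_ℝ • ‖z‖⁻¹ • z - ⟪‖z‖⁻¹ • z, x⟫_ℝ • ‖u‖⁻¹ • u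
      = (‖u‖⁻¹ * ‖z‖⁻¹) • (⟪u, x⟫_ℝ • z - ⟪z, x⟫_ℝ • u) := by
    intro x
    rw [inner_smul_left, inner_smul_left]
    simp only [conj_trivial]
    module
  simp only [h2, map_smul, smul_eq_mul] at h
  rw [integral_const_mul] at h
  have hne := mul_ne_zero (inv_ne_zero hu') (inv_ne_zero hz')
  exact (mul_eq_zero.1 h).resolve_left hne

/-- Integration by parts on the unit sphere. -/
theorem integral_sphere_tangential [Nontrivial E] {F : E → ℝ} {F' : E → E →L[ℝ] ℝ}
    (hF : ∀ ζ ∈ sphere (0 : E) 1, HasFDerivAt F (F' ζ) ζ)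
    (hF' : ContinuousOn F' (sphere (0 : E) 1)) (y : E) :
    ∫ ζ, (F' (ζ : E) y - ⟪y, (ζ : E)⟫_ℝ * F' (ζ : E) ζ) ∂(sphereMeasure E) =
      ((Module.finrank ℝ E : ℝ) - 1) * ∫ ζ, F (ζ : E) * ⟪y, (ζ : E)⟫_ℝ ∂(sphereMeasure E) := by
  have hFc : ContinuousOn F (sphere (0 : E) 1) :=
    fun x hx => (hF x hx).continuousAt.continuousWithinAt
  have hFS : Continuous fun ζ : sphere (0 : E) 1 => F ζ :=
    hFc.comp_continuous continuous_subtype_val (fun ζ => ζ.2)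
  have hFS' : Continuous fun ζ : sphere (0 : E) 1 => F' ζ :=
    hF'.comp_continuous continuous_subtype_val (fun ζ => ζ.2)
  set b := stdOrthonormalBasis ℝ E
  have hj : ∀ j, ∫ ζ : sphere (0 : E) 1, (F ζ * (⟪b j, (ζ : E)⟫_ℝ * ⟪y, b j⟫_ℝ - ⟪y, (ζ : E)⟫_ℝ) +
      ⟪b j, (ζ : E)⟫_ℝ * (⟪b j, (ζ : E)⟫_ℝ * F' ζ y - ⟪y, (ζ : E)⟫_ℝ * F' ζ (b j)))
      ∂(sphereMeasure E) = 0 := by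
    intro j
    -- The rotation in the plane of `b j` and `y` acts on `F` times the `j`-th coordinate. Summing
    -- over `j`, the coordinate derivatives produce the factor `1 - n` and the rest is the
    -- tangential derivative of `F` along `y`.
    have h := integral_sphere_rotation (E := E) (F := fun x => F x * ⟪b j, x⟫_ℝ)
      (F' := fun x => F x • innerSL ℝ (b j) + ⟪b j, x⟫_ℝ • F' x)
      (fun ζ hζ => (hF ζ hζ).mul (innerSL ℝ (b j)).hasFDerivAt)
      (by
        have hb : ContinuousOn (fun x => ⟪b j, x⟫_ℝ) (sphere (0 : E) 1) := by fun_prop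
        exact (hFc.smul continuousOn_const).add (hb.smul hF')) (b j) y
    rw [← h]
    congr 1
    ext ζ
    simp [inner_sub_right, inner_smul_right, real_inner_comm y]
  have hc : ∀ (A : sphere (0 : E) 1 → ℝ) (B : sphere (0 : E) 1 → E →L[ℝ] ℝ), Continuous A →
      Continuous B → (∀ j, Continuous fun ζ : sphere (0 : E) 1 =>
        A ζ * (⟪b j, (ζ : E)⟫_ℝ * ⟪y, b j⟫_ℝ - ⟪y, (ζ : E)⟫_ℝ) +
        ⟪b j, (ζ : E)⟫_ℝ * (⟪b j, (ζ : E)⟫_ℝ * B ζ y - ⟪y, (ζ : E)⟫_ℝ * B ζ (b j))) ∧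
      (Continuous fun ζ : sphere (0 : E) 1 => B ζ y - ⟪y, (ζ : E)⟫_ℝ * B ζ ζ) ∧
      Continuous fun ζ : sphere (0 : E) 1 => A ζ * ⟪y, (ζ : E)⟫_ℝ := by
    intro A B hA hB
    refine ⟨fun j => ?_, ?_, ?_⟩ <;> fun_prop
  obtain ⟨hc1, hc2, hc3⟩ := hc _ _ hFS hFS'
  have hsum := Finset.sum_eq_zero (s := Finset.univ) (fun j _ => hj j)
  rw [← integral_finsetSum _ (fun j _ => (hc1 j).integrable_sphere)] at hsum
  have hpt : ∀ ζ : sphere (0 : E) 1,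
      ∑ j, (F ζ * (⟪b j, (ζ : E)⟫_ℝ * ⟪y, b j⟫_ℝ - ⟪y, (ζ : E)⟫_ℝ) +
      ⟪b j, (ζ : E)⟫_ℝ * (⟪b j, (ζ : E)⟫_ℝ * F' ζ y - ⟪y, (ζ : E)⟫_ℝ * F' ζ (b j)))
      = (F' (ζ : E) y - ⟪y, (ζ : E)⟫_ℝ * F' (ζ : E) ζ)
        - ((Module.finrank ℝ E : ℝ) - 1) * (F ζ * ⟪y, (ζ : E)⟫_ℝ) := by
    intro ζ
    have h1 : ∑ j, ⟪b j, (ζ : E)⟫_ℝ * ⟪y, b j⟫_ℝ = ⟪y, (ζ : E)⟫_ℝ := by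
      rw [← b.sum_inner_mul_inner y (ζ : E)]
      exact Finset.sum_congr rfl fun j _ => mul_comm _ _
    have h2 : ∑ j, ⟪b j, (ζ : E)⟫_ℝ * ⟪b j, (ζ : E)⟫_ℝ = 1 := by
      have := b.sum_inner_mul_inner (ζ : E) (ζ : E)
      rw [real_inner_self_eq_norm_sq, norm_sphere_coe] at this
      rw [one_pow] at this
      exact (Finset.sum_congr rfl fun j _ => by rw [real_inner_comm (b j)]).trans this
    have h3 : ∑ j, ⟪b j, (ζ : E)⟫_ℝ * F' ζ (b j) = F' ζ ζ := by
      have h := congrArg (F' ζ) (b.sum_repr' (ζ : E))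
      simpa only [map_sum, map_smul, smul_eq_mul] using h
    calc _ = F ζ * (∑ j, ⟪b j, (ζ : E)⟫_ℝ * ⟪y, b j⟫_ℝ) -
          F ζ * ∑ _j : Fin (Module.finrank ℝ E), ⟪y, (ζ : E)⟫_ℝ +
          ((∑ j, ⟪b j, (ζ : E)⟫_ℝ * ⟪b j, (ζ : E)⟫_ℝ) * F' ζ y -
            ⟪y, (ζ : E)⟫_ℝ * ∑ j, ⟪b j, (ζ : E)⟫_ℝ * F' ζ (b j)) := by
          simp only [Finset.mul_sum, Finset.sum_mul, ← Finset.sum_sub_distrib,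
            ← Finset.sum_add_distrib]
          exact Finset.sum_congr rfl fun j _ => by ring
      _ = _ := by
          rw [h1, h2, h3]
          simp
          ring
  simp only [hpt] at hsum
  rw [integral_sub hc2.integrable_sphere (hc3.integrable_sphere.const_mul _),
    integral_const_mul, sub_eq_zero] at hsum
  exact hsum

end SphereMeasure

/-! ### The distribution of heights on the sphere, by Stein's method. -/

section HeightDistribution

/-- The solution `f` of `(1 - x²) f' - 2 x f = |x - t| - (1 + t²) / 2` that is regular on
`[-1, 1]`. -/
noncomputable def steinSolution (t x : ℝ) : ℝ :=
  (1 / 2 - (1 - t) ^ 2 / (2 * (1 - min x t))) + (-1 / 2 + (1 + t) ^ 2 / (2 * (1 + max x t))) - t / 2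

/-- The derivative of `steinSolution t`. -/
noncomputable def steinSolutionDeriv (t x : ℝ) : ℝ :=
  -(1 - t) ^ 2 / (2 * (1 - min x t) ^ 2) - (1 + t) ^ 2 / (2 * (1 + max x t) ^ 2) + 1 / 2

theorem steinSolution_of_le {t x : ℝ} (ht : |t| < 1) (hx : x ≤ t) :
    steinSolution t x = 1 / 2 - (1 - t) ^ 2 / (2 * (1 - x)) := by
  obtain ⟨h1, h2⟩ := abs_lt.1 ht
  have : 1 + t ≠ 0 := by linarith
  have h3 : 1 - x ≠ 0 := by linarith
  rw [steinSolution, min_eq_left hx, max_eq_right hx]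
  field_simp
  ring

theorem steinSolution_of_ge {t x : ℝ} (ht : |t| < 1) (hx : t ≤ x) :
    steinSolution t x = -1 / 2 + (1 + t) ^ 2 / (2 * (1 + x)) := by
  obtain ⟨h1, h2⟩ := abs_lt.1 ht
  have : 1 - t ≠ 0 := by linarith
  have h3 : 1 + x ≠ 0 := by linarith
  rw [steinSolution, min_eq_right hx, max_eq_left hx]
  field_simp
  ring

theorem steinSolutionDeriv_of_le {t x : ℝ} (ht : |t| < 1) (hx : x ≤ t) :
    steinSolutionDeriv t x = -(1 - t) ^ 2 / (2 * (1 - x) ^ 2) := by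
  obtain ⟨h1, h2⟩ := abs_lt.1 ht
  have : 1 + t ≠ 0 := by linarith
  have h3 : 1 - x ≠ 0 := by linarith
  rw [steinSolutionDeriv, min_eq_left hx, max_eq_right hx]
  field_simp
  ring

theorem steinSolutionDeriv_of_ge {t x : ℝ} (ht : |t| < 1) (hx : t ≤ x) :
    steinSolutionDeriv t x = -(1 + t) ^ 2 / (2 * (1 + x) ^ 2) := by
  obtain ⟨h1, h2⟩ := abs_lt.1 ht
  have : 1 - t ≠ 0 := by linarith
  have h3 : 1 + x ≠ 0 := by linarith
  rw [steinSolutionDeriv, min_eq_right hx, max_eq_left hx]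
  field_simp
  ring

theorem hasDerivAt_steinSolution {t : ℝ} (ht : |t| < 1) (x : ℝ) :
    HasDerivAt (steinSolution t) (steinSolutionDeriv t x) x := by
  obtain ⟨h1, h2⟩ := abs_lt.1 ht
  have hl : x ≤ t → HasDerivAt (fun x => 1 / 2 - (1 - t) ^ 2 / (2 * (1 - x)))
      (steinSolutionDeriv t x) x := by
    intro hx
    have h3 : 1 - x ≠ 0 := by linarith
    have h4 : HasDerivAt (fun x : ℝ => 2 * (1 - x)) (2 * (-1)) x :=
      ((hasDerivAt_id x).const_sub 1).const_mul 2
    have h5 := ((hasDerivAt_const x ((1 - t) ^ 2)).div h4 (by simpa using h3)).const_sub (1 / 2)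
    rw [steinSolutionDeriv_of_le ht hx]
    refine h5.congr_deriv ?_
    field_simp
    ring
  have hr : t ≤ x → HasDerivAt (fun x => -1 / 2 + (1 + t) ^ 2 / (2 * (1 + x)))
      (steinSolutionDeriv t x) x := by
    intro hx
    have h3 : 1 + x ≠ 0 := by linarith
    have h4 : HasDerivAt (fun x : ℝ => 2 * (1 + x)) (2 * 1) x :=
      ((hasDerivAt_id x).const_add 1).const_mul 2
    have h5 := ((hasDerivAt_const x ((1 + t) ^ 2)).div h4 (by simpa using h3)).const_add (-1 / 2)
    rw [steinSolutionDeriv_of_ge ht hx]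
    refine h5.congr_deriv ?_
    field_simp
    ring
  rcases lt_trichotomy x t with h | h | h
  · refine (hl h.le).congr_of_eventuallyEq ?_
    filter_upwards [Iio_mem_nhds h] with y hy
    exact steinSolution_of_le ht (le_of_lt hy)
  · have h5 : HasDerivWithinAt (steinSolution t) (steinSolutionDeriv t x) (Iic x) x :=
      (hl h.le).hasDerivWithinAt.congr (fun y hy => steinSolution_of_le ht (hy.trans h.le))
        (steinSolution_of_le ht h.le)
    have h6 : HasDerivWithinAt (steinSolution t) (steinSolutionDeriv t x) (Ici x) x :=
      (hr h.ge).hasDerivWithinAt.congr (fun y hy => steinSolution_of_ge ht (h.ge.trans hy))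
        (steinSolution_of_ge ht h.ge)
    have := h5.union h6
    rwa [Iic_union_Ici, hasDerivWithinAt_univ] at this
  · refine (hr h.le).congr_of_eventuallyEq ?_
    filter_upwards [Ioi_mem_nhds h] with y hy
    exact steinSolution_of_ge ht (le_of_lt hy)

theorem continuous_steinSolution {t : ℝ} (ht : |t| < 1) : Continuous (steinSolution t) :=
  continuous_iff_continuousAt.2 fun x => (hasDerivAt_steinSolution ht x).continuousAt

theorem continuous_steinSolutionDeriv {t : ℝ} (ht : |t| < 1) :
    Continuous (steinSolutionDeriv t) := by
  obtain ⟨h1, h2⟩ := abs_lt.1 ht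
  unfold steinSolutionDeriv
  have h3 : ∀ x : ℝ, 2 * (1 - min x t) ^ 2 ≠ 0 := fun x => by
    have := min_le_right x t
    have : 0 < 1 - min x t := by linarith
    positivity
  have h4 : ∀ x : ℝ, 2 * (1 + max x t) ^ 2 ≠ 0 := fun x => by
    have := le_max_right x t
    have : 0 < 1 + max x t := by linarith
    positivity
  fun_prop (disch := assumption)

/-- The left side is the derivative of `(1 - x²) f`. Regularity at `±1` requires the right side to
have mean zero on `[-1, 1]`, which fixes the constant as the average `(1 + t²) / 2` of `|x - t|`
there. -/
theorem steinSolution_equation {t : ℝ} (ht : |t| < 1) (x : ℝ) :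
    (1 - x ^ 2) * steinSolutionDeriv t x - 2 * (steinSolution t x * x)
      = |x - t| - (1 + t ^ 2) / 2 := by
  obtain ⟨h1, h2⟩ := abs_lt.1 ht
  rcases le_total x t with h | h
  · have h3 : 1 - x ≠ 0 := by linarith
    rw [steinSolutionDeriv_of_le ht h, steinSolution_of_le ht h, abs_of_nonpos (by linarith)]
    field_simp
    ring
  · have h3 : 1 + x ≠ 0 := by linarith
    rw [steinSolutionDeriv_of_ge ht h, steinSolution_of_ge ht h, abs_of_nonneg (by linarith)]
    field_simp
    ring

/-- This sign makes the estimate hold in dimensions above three. Each position of `x` and `-x`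
relative to `t` gives an explicit rational function. -/
theorem steinSolution_odd_part_neg {t : ℝ} (ht : |t| < 1) {x : ℝ} (hx0 : x ≠ 0) :
    x * (steinSolution t x - steinSolution t (-x)) < 0 := by
  obtain ⟨h1, h2⟩ := abs_lt.1 ht
  have hx2 : 0 < x ^ 2 := by positivity
  rcases le_total x t with h | h <;> rcases le_total (-x) t with h' | h'
  · rw [steinSolution_of_le ht h, steinSolution_of_le ht h']
    have h3 : 0 < 1 - x := by linarith
    have h4 : 0 < 1 + x := by linarith
    have h5 : 0 < 1 - t := by linarith
    have : x * (1 / 2 - (1 - t) ^ 2 / (2 * (1 - x)) - (1 / 2 - (1 - t) ^ 2 / (2 * (1 - -x))))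
        = -((1 - t) ^ 2 * x ^ 2 / ((1 - x) * (1 + x))) := by
      rw [sub_neg_eq_add]
      field_simp
      ring
    rw [this, neg_lt_zero]
    positivity
  · rw [steinSolution_of_le ht h, steinSolution_of_ge ht h']
    have h3 : 0 < 1 - x := by linarith
    have h4 : x < 0 := lt_of_le_of_ne (by linarith) hx0
    have h6 : |t| ≤ -x := abs_le.2 ⟨by linarith, h'⟩
    -- Uses `|t| < 1`: `t² ≤ |t| ≤ -x`, and one of the two inequalities is strict since `x ≠ 0`.
    have h5 : 0 < -x - t ^ 2 := by nlinarith [sq_abs t, abs_nonneg t]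
    have : x * (1 / 2 - (1 - t) ^ 2 / (2 * (1 - x)) - (-1 / 2 + (1 + t) ^ 2 / (2 * (1 + -x))))
        = -((-x) * (-x - t ^ 2) / (1 - x)) := by
      rw [← sub_eq_add_neg]
      field_simp
      ring
    rw [this, neg_lt_zero]
    have : 0 < -x := by linarith
    positivity
  · rw [steinSolution_of_ge ht h, steinSolution_of_le ht h']
    have h3 : 0 < 1 + x := by linarith
    have h4 : 0 < x := lt_of_le_of_ne (by linarith) hx0.symm
    have h6 : |t| ≤ x := abs_le.2 ⟨by linarith, h⟩
    have h5 : 0 < x - t ^ 2 := by nlinarith [sq_abs t, abs_nonneg t]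
    have : x * (-1 / 2 + (1 + t) ^ 2 / (2 * (1 + x)) - (1 / 2 - (1 - t) ^ 2 / (2 * (1 - -x))))
        = -(x * (x - t ^ 2) / (1 + x)) := by
      rw [sub_neg_eq_add]
      field_simp
      ring
    rw [this, neg_lt_zero]
    positivity
  · rw [steinSolution_of_ge ht h, steinSolution_of_ge ht h']
    have h3 : 0 < 1 - x := by linarith
    have h4 : 0 < 1 + x := by linarith
    have h5 : 0 < 1 + t := by linarith
    have : x * (-1 / 2 + (1 + t) ^ 2 / (2 * (1 + x)) - (-1 / 2 + (1 + t) ^ 2 / (2 * (1 + -x))))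
        = -((1 + t) ^ 2 * x ^ 2 / ((1 - x) * (1 + x))) := by
      rw [← sub_eq_add_neg]
      field_simp
      ring
    rw [this, neg_lt_zero]
    positivity

variable {E : Type*} [NormedAddCommGroup E] [InnerProductSpace ℝ E] [FiniteDimensional ℝ E]
  [MeasurableSpace E] [BorelSpace E]

/-- The Stein identity for the height `⟪e, ζ⟫` on the unit sphere. -/
theorem integral_sphere_stein [Nontrivial E] {f f' : ℝ → ℝ} (hf : ∀ x, HasDerivAt f (f' x) x)
    (hf' : Continuous f') {e : E} (he : ‖e‖ = 1) :
    ∫ ζ, (1 - ⟪e, (ζ : E)⟫_ℝ ^ 2) * f' ⟪e, (ζ : E)⟫_ℝ ∂(sphereMeasure E) =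
      ((Module.finrank ℝ E : ℝ) - 1) *
        ∫ ζ, f ⟪e, (ζ : E)⟫_ℝ * ⟪e, (ζ : E)⟫_ℝ ∂(sphereMeasure E) := by
  have h := integral_sphere_tangential (E := E) (F := fun x => f ⟪e, x⟫_ℝ)
    (F' := fun x => f' ⟪e, x⟫_ℝ • innerSL ℝ e)
    (fun ζ _ => (hf _).comp_hasFDerivAt ζ (innerSL ℝ e).hasFDerivAt) (by fun_prop) e
  rw [← h]
  congr 1
  ext ζ
  simp [he]
  ring

theorem integral_sphere_inner_sq [Nontrivial E] {e : E} (he : ‖e‖ = 1) :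
    (Module.finrank ℝ E : ℝ) * ∫ ζ, ⟪e, (ζ : E)⟫_ℝ ^ 2 ∂(sphereMeasure E) = 1 := by
  have h := integral_sphere_stein (f := fun x => x) (f' := fun _ => 1) (fun x => hasDerivAt_id x)
    continuous_const he
  simp only [mul_one, ← pow_two] at h
  rw [integral_sub (integrable_const _) (Continuous.integrable_sphere (by fun_prop))] at h
  simp at h
  linarith

/-- The Stein identity turns `(1 - x²) f'` into `(n - 1) x f`, while the equation for `f` subtracts
`2 x f`; hence the factor `n - 3`. -/
theorem integral_sphere_abs_inner_sub_eq [Nontrivial E] {t : ℝ} (ht : |t| < 1) {e : E}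
    (he : ‖e‖ = 1) :
    ∫ ζ, |⟪e, (ζ : E)⟫_ℝ - t| ∂(sphereMeasure E) = (1 + t ^ 2) / 2 +
      ((Module.finrank ℝ E : ℝ) - 3) / 2 * ∫ ζ, ⟪e, (ζ : E)⟫_ℝ *
        (steinSolution t ⟪e, (ζ : E)⟫_ℝ - steinSolution t (-⟪e, (ζ : E)⟫_ℝ))
        ∂(sphereMeasure E) := by
  have hc := continuous_steinSolution ht
  have hc' := continuous_steinSolutionDeriv ht
  have h := integral_sphere_stein (hasDerivAt_steinSolution ht) hc' he
  have h1 : ∫ ζ : sphere (0 : E) 1, |⟪e, (ζ : E)⟫_ℝ - t| ∂(sphereMeasure E) =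
      ∫ ζ : sphere (0 : E) 1, ((1 - ⟪e, (ζ : E)⟫_ℝ ^ 2) * steinSolutionDeriv t ⟪e, (ζ : E)⟫_ℝ
        - 2 * (steinSolution t ⟪e, (ζ : E)⟫_ℝ * ⟪e, (ζ : E)⟫_ℝ) + (1 + t ^ 2) / 2)
        ∂(sphereMeasure E) := by
    congr 1
    ext ζ
    rw [steinSolution_equation ht]
    ring
  rw [h1, integral_add (Continuous.integrable_sphere (by fun_prop)) (integrable_const _),
    integral_sub (Continuous.integrable_sphere (by fun_prop))
      (Continuous.integrable_sphere (by fun_prop)), integral_const_mul, h]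
  -- Antipodal symmetry replaces `f` by its odd part.
  have h2 := integral_sphere_comp_isometry (LinearIsometryEquiv.neg ℝ (E := E))
    (fun x => steinSolution t ⟪e, x⟫_ℝ * ⟪e, x⟫_ℝ)
  simp only [LinearIsometryEquiv.coe_neg, inner_neg_right] at h2
  have h3 : ∫ ζ : sphere (0 : E) 1, ⟪e, (ζ : E)⟫_ℝ *
        (steinSolution t ⟪e, (ζ : E)⟫_ℝ - steinSolution t (-⟪e, (ζ : E)⟫_ℝ)) ∂(sphereMeasure E)
      = 2 * ∫ ζ : sphere (0 : E) 1, steinSolution t ⟪e, (ζ : E)⟫_ℝ * ⟪e, (ζ : E)⟫_ℝ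
        ∂(sphereMeasure E) := by
    rw [two_mul]
    nth_rewrite 2 [← h2]
    rw [← integral_add (Continuous.integrable_sphere (by fun_prop))
      (Continuous.integrable_sphere (by fun_prop))]
    congr 1
    ext ζ
    ring
  rw [h3]
  simp
  ring

theorem integral_sphere_steinSolution_neg [Nontrivial E] {t : ℝ} (ht : |t| < 1) {e : E}
    (he : ‖e‖ = 1) :
    ∫ ζ, ⟪e, (ζ : E)⟫_ℝ *
        (steinSolution t ⟪e, (ζ : E)⟫_ℝ - steinSolution t (-⟪e, (ζ : E)⟫_ℝ))
        ∂(sphereMeasure E) < 0 := by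
  have hc := continuous_steinSolution ht
  set G : sphere (0 : E) 1 → ℝ := fun ζ => -(⟪e, (ζ : E)⟫_ℝ *
        (steinSolution t ⟪e, (ζ : E)⟫_ℝ - steinSolution t (-⟪e, (ζ : E)⟫_ℝ))) with hG
  have hG0 : 0 ≤ G := by
    intro ζ
    by_cases h : ⟪e, (ζ : E)⟫_ℝ = 0
    · simp [hG, h]
    · simpa [hG] using (steinSolution_odd_part_neg ht h).le
  have hint : Integrable G (sphereMeasure E) := Continuous.integrable_sphere (by fun_prop)
  have h0 : 0 ≤ ∫ ζ, G ζ ∂(sphereMeasure E) := integral_nonneg hG0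
  have hne : ∫ ζ, G ζ ∂(sphereMeasure E) ≠ 0 := by
    intro h
    rw [integral_eq_zero_iff_of_nonneg hG0 hint] at h
    -- A vanishing integral would put almost all of the sphere on the equator, against the second
    -- moment `1 / n` of the height.
    have h2 : ∀ᵐ ζ : sphere (0 : E) 1 ∂(sphereMeasure E), ⟪e, (ζ : E)⟫_ℝ ^ 2 = 0 := by
      filter_upwards [h] with ζ hζ
      by_contra hne
      have := steinSolution_odd_part_neg ht (x := ⟪e, (ζ : E)⟫_ℝ) (fun h => hne (by simp [h]))
      simp only [hG, Pi.zero_apply, neg_eq_zero] at hζ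
      linarith
    have h3 := integral_sphere_inner_sq he
    rw [integral_congr_ae (g := fun _ => (0 : ℝ)) h2] at h3
    simp at h3
  have := lt_of_le_of_ne h0 hne.symm
  simp only [hG, integral_neg] at this
  linarith

theorem integral_sphere_abs_inner_sub_le [Nontrivial E] (hE : 3 ≤ Module.finrank ℝ E) {t : ℝ}
    (ht : |t| < 1) {e : E} (he : ‖e‖ = 1) :
    ∫ ζ, |⟪e, (ζ : E)⟫_ℝ - t| ∂(sphereMeasure E) ≤ (1 + t ^ 2) / 2 := by
  rw [integral_sphere_abs_inner_sub_eq ht he]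
  have h : (3 : ℝ) ≤ Module.finrank ℝ E := by exact_mod_cast hE
  nlinarith [integral_sphere_steinSolution_neg ht he]

theorem integral_sphere_abs_inner_sub_lt [Nontrivial E] (hE : 4 ≤ Module.finrank ℝ E) {t : ℝ}
    (ht : |t| < 1) {e : E} (he : ‖e‖ = 1) :
    ∫ ζ, |⟪e, (ζ : E)⟫_ℝ - t| ∂(sphereMeasure E) < (1 + t ^ 2) / 2 := by
  rw [integral_sphere_abs_inner_sub_eq ht he]
  have h : (4 : ℝ) ≤ Module.finrank ℝ E := by exact_mod_cast hE
  nlinarith [integral_sphere_steinSolution_neg ht he]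

end HeightDistribution

/-! ### Differential identities for spherical means and first moments. -/

section SphericalMeans

variable {E : Type*} [NormedAddCommGroup E] [InnerProductSpace ℝ E]

theorem smul_sphere_mem_ball {r : ℝ} (hr : r ∈ Ioo (-1 : ℝ) 1) {x : E}
    (hx : x ∈ sphere (0 : E) 1) : r • x ∈ ball (0 : E) 1 := by
  rw [mem_sphere_zero_iff_norm] at hx
  rw [mem_ball_zero_iff, norm_smul, hx, mul_one, Real.norm_eq_abs]
  exact abs_lt.2 hr

theorem continuousOn_smul_Ioo_sphere {G : Type*} [TopologicalSpace G] {f : E → G}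
    (hf : ContinuousOn f (ball 0 1)) :
    ContinuousOn (fun p : ℝ × sphere (0 : E) 1 => f (p.1 • (p.2 : E))) (Ioo (-1) 1 ×ˢ univ) :=
  hf.comp (by fun_prop) fun p hp => smul_sphere_mem_ball hp.1 p.2.2

theorem continuous_smul_sphere {G : Type*} [TopologicalSpace G] {f : E → G}
    (hf : ContinuousOn f (ball 0 1)) {r : ℝ} (hr : r ∈ Ioo (-1 : ℝ) 1) :
    Continuous fun ζ : sphere (0 : E) 1 => f (r • (ζ : E)) :=
  hf.comp_continuous (by fun_prop) fun ζ => smul_sphere_mem_ball hr ζ.2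

theorem hasDerivAt_comp_smul_right {F : Type*} [NormedAddCommGroup F] [NormedSpace ℝ F]
    {f : E → F} {f' : E →L[ℝ] F} {r : ℝ} {x : E} (hf : HasFDerivAt f f' (r • x)) :
    HasDerivAt (fun t : ℝ => f (t • x)) (f' x) r := by
  have h : HasDerivAt (fun t : ℝ => t • x) x r := by
    simpa using (hasDerivAt_id r).smul_const x
  exact hf.comp_hasDerivAt r h

theorem hasFDerivAt_comp_smul_left {f : E → ℝ} {f' : E →L[ℝ] ℝ} {r : ℝ} {x : E}
    (hf : HasFDerivAt f f' (r • x)) :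
    HasFDerivAt (fun y : E => f (r • y)) (r • f') x := by
  have h := hf.comp x ((hasFDerivAt_id (𝕜 := ℝ) x).const_smul r)
  refine h.congr_fderiv ?_
  ext v
  simp

theorem fderiv_hasFDerivAt_of_contDiffOn {h : E → ℝ} (hC : ContDiffOn ℝ 2 h (ball 0 1)) {x : E}
    (hx : x ∈ ball (0 : E) 1) : HasFDerivAt h (fderiv ℝ h x) x :=
  ((hC.contDiffAt (isOpen_ball.mem_nhds hx)).differentiableAt (by norm_num)).hasFDerivAt

theorem contDiffOn_fderiv_ball {h : E → ℝ} (hC : ContDiffOn ℝ 2 h (ball 0 1)) :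
    ContDiffOn ℝ 1 (fderiv ℝ h) (ball 0 1) :=
  hC.fderiv_of_isOpen isOpen_ball (by norm_num)

theorem continuousOn_fderiv_ball {h : E → ℝ} (hC : ContDiffOn ℝ 2 h (ball 0 1)) :
    ContinuousOn (fderiv ℝ h) (ball 0 1) :=
  (contDiffOn_fderiv_ball hC).continuousOn

theorem continuousOn_fderiv_fderiv_ball {h : E → ℝ} (hC : ContDiffOn ℝ 2 h (ball 0 1)) :
    ContinuousOn (fderiv ℝ (fderiv ℝ h)) (ball 0 1) :=
  (contDiffOn_fderiv_ball hC).continuousOn_fderiv_of_isOpen isOpen_ball (by norm_num)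

theorem fderiv_hasFDerivAt_fderiv_of_contDiffOn {h : E → ℝ} (hC : ContDiffOn ℝ 2 h (ball 0 1))
    {x : E} (hx : x ∈ ball (0 : E) 1) :
    HasFDerivAt (fderiv ℝ h) (fderiv ℝ (fderiv ℝ h) x) x :=
  (((contDiffOn_fderiv_ball hC).contDiffAt (isOpen_ball.mem_nhds hx)).differentiableAt
    (by norm_num)).hasFDerivAt

theorem fderiv_fderiv_symm_of_contDiffOn {h : E → ℝ} (hC : ContDiffOn ℝ 2 h (ball 0 1))
    {x : E} (hx : x ∈ ball (0 : E) 1) (v w : E) :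
    fderiv ℝ (fderiv ℝ h) x v w = fderiv ℝ (fderiv ℝ h) x w v :=
  (hC.contDiffAt (isOpen_ball.mem_nhds hx)).isSymmSndFDerivAt (by simp) v w

theorem hasFDerivAt_fderiv_apply_comp_smul {h : E → ℝ} (hC : ContDiffOn ℝ 2 h (ball 0 1))
    {r : ℝ} (hr : r ∈ Ioo (-1 : ℝ) 1) (w : E) {x : E} (hx : x ∈ sphere (0 : E) 1) :
    HasFDerivAt (fun y : E => fderiv ℝ h (r • y) w)
      (r • (ContinuousLinearMap.apply ℝ ℝ w).comp (fderiv ℝ (fderiv ℝ h) (r • x))) x :=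
  hasFDerivAt_comp_smul_left (f := fun y => fderiv ℝ h y w)
    ((ContinuousLinearMap.apply ℝ ℝ w).hasFDerivAt.comp _
      (fderiv_hasFDerivAt_fderiv_of_contDiffOn hC (smul_sphere_mem_ball hr hx)))

theorem continuousOn_fderiv_fderiv_apply_comp_smul {h : E → ℝ}
    (hC : ContDiffOn ℝ 2 h (ball 0 1)) {r : ℝ} (hr : r ∈ Ioo (-1 : ℝ) 1) (w : E) :
    ContinuousOn (fun x : E =>
      r • (ContinuousLinearMap.apply ℝ ℝ w).comp (fderiv ℝ (fderiv ℝ h) (r • x)))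
      (sphere (0 : E) 1) := by
  have h1 : ContinuousOn (fun x : E => fderiv ℝ (fderiv ℝ h) (r • x)) (sphere (0 : E) 1) :=
    (continuousOn_fderiv_fderiv_ball hC).comp (by fun_prop)
      fun x hx => smul_sphere_mem_ball hr hx
  exact (continuousOn_const.clm_comp h1).const_smul r

variable [FiniteDimensional ℝ E]

theorem laplacian_eq_sum_fderiv_fderiv {ι : Type*} [Fintype ι] (b : OrthonormalBasis ι ℝ E)
    (h : E → ℝ) (x : E) :
    Laplacian.laplacian h x = ∑ i, fderiv ℝ (fderiv ℝ h) x (b i) (b i) := by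
  rw [laplacian_eq_iteratedFDeriv_orthonormalBasis h b]
  simp [iteratedFDeriv_two_apply]

theorem continuousOn_laplacian_ball {h : E → ℝ} (hC : ContDiffOn ℝ 2 h (ball 0 1)) :
    ContinuousOn (Laplacian.laplacian h) (ball 0 1) := by
  have h1 := continuousOn_fderiv_fderiv_ball hC
  have : Laplacian.laplacian h = fun x => ∑ i, fderiv ℝ (fderiv ℝ h) x
      (stdOrthonormalBasis ℝ E i) (stdOrthonormalBasis ℝ E i) := by
    ext x
    exact laplacian_eq_sum_fderiv_fderiv _ h x
  rw [this]
  exact continuousOn_finsetSum _ fun i _ =>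
    (h1.clm_apply continuousOn_const).clm_apply continuousOn_const

variable [MeasurableSpace E] [BorelSpace E] [Nontrivial E]

theorem hasDerivAt_integral_smul_sphere {h : E → ℝ} (hC : ContDiffOn ℝ 2 h (ball 0 1))
    {ω : E → ℝ} (hω : Continuous ω) {r : ℝ} (hr : r ∈ Ioo (-1 : ℝ) 1) :
    HasDerivAt (fun t => ∫ ζ, h (t • (ζ : E)) * ω ζ ∂(sphereMeasure E))
      (∫ ζ, fderiv ℝ h (r • (ζ : E)) ζ * ω ζ ∂(sphereMeasure E)) r := by
  refine hasDerivAt_integral_sphere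
    (g := fun t (ζ : sphere (0 : E) 1) => h (t • (ζ : E)) * ω (ζ : E))
    (g' := fun t (ζ : sphere (0 : E) 1) => fderiv ℝ h (t • (ζ : E)) (ζ : E) * ω (ζ : E))
    isOpen_Ioo ?_ ?_ ?_ hr
  · intro t ht
    exact (continuous_smul_sphere hC.continuousOn ht).mul (by fun_prop)
  · intro t ht ζ
    exact (hasDerivAt_comp_smul_right (fderiv_hasFDerivAt_of_contDiffOn hC
      (smul_sphere_mem_ball ht ζ.2))).mul_const _
  · refine ((continuousOn_smul_Ioo_sphere (continuousOn_fderiv_ball hC)).clm_apply ?_).mul ?_ <;>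
      fun_prop

theorem hasDerivAt_integral_fderiv_radial {h : E → ℝ} (hC : ContDiffOn ℝ 2 h (ball 0 1))
    {r : ℝ} (hr : r ∈ Ioo (-1 : ℝ) 1) :
    HasDerivAt (fun t => ∫ ζ : sphere (0 : E) 1, fderiv ℝ h (t • (ζ : E)) ζ ∂(sphereMeasure E))
      (∫ ζ : sphere (0 : E) 1, fderiv ℝ (fderiv ℝ h) (r • (ζ : E)) ζ ζ ∂(sphereMeasure E)) r := by
  refine hasDerivAt_integral_sphere
    (g := fun t (ζ : sphere (0 : E) 1) => fderiv ℝ h (t • (ζ : E)) (ζ : E))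
    (g' := fun t (ζ : sphere (0 : E) 1) => fderiv ℝ (fderiv ℝ h) (t • (ζ : E)) (ζ : E) (ζ : E))
    isOpen_Ioo ?_ ?_ ?_ hr
  · intro t ht
    exact (continuous_smul_sphere (continuousOn_fderiv_ball hC) ht).clm_apply (by fun_prop)
  · intro t ht ζ
    have := hasDerivAt_comp_smul_right (fderiv_hasFDerivAt_fderiv_of_contDiffOn hC
      (smul_sphere_mem_ball ht ζ.2))
    simpa using this.clm_apply (hasDerivAt_const t (ζ : E))
  · refine ((continuousOn_smul_Ioo_sphere
      (continuousOn_fderiv_fderiv_ball hC)).clm_apply ?_).clm_apply ?_ <;> fun_prop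

theorem hasDerivAt_integral_fderiv_const {h : E → ℝ} (hC : ContDiffOn ℝ 2 h (ball 0 1)) (e : E)
    {r : ℝ} (hr : r ∈ Ioo (-1 : ℝ) 1) :
    HasDerivAt (fun t => ∫ ζ : sphere (0 : E) 1, fderiv ℝ h (t • (ζ : E)) e ∂(sphereMeasure E))
      (∫ ζ : sphere (0 : E) 1, fderiv ℝ (fderiv ℝ h) (r • (ζ : E)) ζ e ∂(sphereMeasure E)) r := by
  refine hasDerivAt_integral_sphere
    (g := fun t (ζ : sphere (0 : E) 1) => fderiv ℝ h (t • (ζ : E)) e)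
    (g' := fun t (ζ : sphere (0 : E) 1) => fderiv ℝ (fderiv ℝ h) (t • (ζ : E)) (ζ : E) e)
    isOpen_Ioo ?_ ?_ ?_ hr
  · intro t ht
    exact (continuous_smul_sphere (continuousOn_fderiv_ball hC) ht).clm_apply (by fun_prop)
  · intro t ht ζ
    have := hasDerivAt_comp_smul_right (fderiv_hasFDerivAt_fderiv_of_contDiffOn hC
      (smul_sphere_mem_ball ht ζ.2))
    simpa using this.clm_apply (hasDerivAt_const t e)
  · refine ((continuousOn_smul_Ioo_sphere
      (continuousOn_fderiv_fderiv_ball hC)).clm_apply ?_).clm_apply ?_ <;> fun_prop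

/-- The Euler–Poisson–Darboux equation for the spherical means. -/
theorem integral_sphere_laplacian {h : E → ℝ} (hC : ContDiffOn ℝ 2 h (ball 0 1))
    {r : ℝ} (hr : r ∈ Ioo (-1 : ℝ) 1) :
    r * ∫ ζ : sphere (0 : E) 1, fderiv ℝ (fderiv ℝ h) (r • (ζ : E)) ζ ζ ∂(sphereMeasure E) +
      ((Module.finrank ℝ E : ℝ) - 1) *
        ∫ ζ : sphere (0 : E) 1, fderiv ℝ h (r • (ζ : E)) ζ ∂(sphereMeasure E) =
      r * ∫ ζ : sphere (0 : E) 1, Laplacian.laplacian h (r • (ζ : E)) ∂(sphereMeasure E) := by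
  set b := stdOrthonormalBasis ℝ E
  have hD1 := continuous_smul_sphere (continuousOn_fderiv_ball hC) hr
  have hD2 := continuous_smul_sphere (continuousOn_fderiv_fderiv_ball hC) hr
  have hL := continuous_smul_sphere (continuousOn_laplacian_ball hC) hr
  have hco : Continuous fun ζ : sphere (0 : E) 1 => (ζ : E) := continuous_subtype_val
  -- Integration by parts for the partial derivative `∂ᵢh(r ·)` in the direction `b i`; the sum over
  -- `i` assembles the Laplacian and the radial derivatives.
  have hi : ∀ i, ∫ ζ : sphere (0 : E) 1, (r * fderiv ℝ (fderiv ℝ h) (r • (ζ : E)) (b i) (b i) -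
      ⟪b i, (ζ : E)⟫_ℝ * (r * fderiv ℝ (fderiv ℝ h) (r • (ζ : E)) ζ (b i))) ∂(sphereMeasure E) =
      ((Module.finrank ℝ E : ℝ) - 1) *
        ∫ ζ : sphere (0 : E) 1, fderiv ℝ h (r • (ζ : E)) (b i) * ⟪b i, (ζ : E)⟫_ℝ
          ∂(sphereMeasure E) := fun i =>
    integral_sphere_tangential
      (fun ζ hζ => hasFDerivAt_fderiv_apply_comp_smul hC hr (b i) hζ)
      (continuousOn_fderiv_fderiv_apply_comp_smul hC hr (b i)) (b i)
  have hsum := Finset.sum_congr (s₁ := Finset.univ) rfl (fun i _ => hi i)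
  have hc0 : ∀ i, Continuous fun ζ : sphere (0 : E) 1 => ⟪b i, (ζ : E)⟫_ℝ := by
    intro i; fun_prop
  have hc1 : ∀ i, Continuous fun ζ : sphere (0 : E) 1 =>
      r * fderiv ℝ (fderiv ℝ h) (r • (ζ : E)) (b i) (b i) -
      ⟪b i, (ζ : E)⟫_ℝ * (r * fderiv ℝ (fderiv ℝ h) (r • (ζ : E)) ζ (b i)) := fun i =>
    (continuous_const.mul ((hD2.clm_apply continuous_const).clm_apply continuous_const)).sub
      ((hc0 i).mul (continuous_const.mul ((hD2.clm_apply hco).clm_apply continuous_const)))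
  have hc2 : ∀ i, Continuous fun ζ : sphere (0 : E) 1 =>
      fderiv ℝ h (r • (ζ : E)) (b i) * ⟪b i, (ζ : E)⟫_ℝ := fun i =>
    (hD1.clm_apply continuous_const).mul (hc0 i)
  rw [← Finset.mul_sum, ← integral_finsetSum _ (fun i _ => (hc1 i).integrable_sphere),
    ← integral_finsetSum _ (fun i _ => (hc2 i).integrable_sphere)] at hsum
  have hp1 : ∀ ζ : sphere (0 : E) 1, ∑ i, fderiv ℝ h (r • (ζ : E)) (b i) * ⟪b i, (ζ : E)⟫_ℝ =
      fderiv ℝ h (r • (ζ : E)) ζ := by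
    intro ζ
    have := congrArg (fderiv ℝ h (r • (ζ : E))) (b.sum_repr' (ζ : E))
    simpa only [map_sum, map_smul, smul_eq_mul, mul_comm] using this
  have hp2 : ∀ ζ : sphere (0 : E) 1,
      ∑ i, (r * fderiv ℝ (fderiv ℝ h) (r • (ζ : E)) (b i) (b i) -
      ⟪b i, (ζ : E)⟫_ℝ * (r * fderiv ℝ (fderiv ℝ h) (r • (ζ : E)) ζ (b i))) =
      r * Laplacian.laplacian h (r • (ζ : E)) -
        r * fderiv ℝ (fderiv ℝ h) (r • (ζ : E)) ζ ζ := by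
    intro ζ
    have := congrArg (fderiv ℝ (fderiv ℝ h) (r • (ζ : E)) ζ) (b.sum_repr' (ζ : E))
    simp only [map_sum, map_smul, smul_eq_mul] at this
    rw [Finset.sum_sub_distrib, laplacian_eq_sum_fderiv_fderiv b, ← this, Finset.mul_sum,
      Finset.mul_sum]
    congr 1
    exact Finset.sum_congr rfl fun i _ => by ring
  simp only [hp1, hp2] at hsum
  rw [integral_sub (hL.integrable_sphere.const_mul r)
    (((hD2.clm_apply hco).clm_apply hco).integrable_sphere.const_mul r), integral_const_mul,
    integral_const_mul] at hsum
  linarith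

/-- The left side is the radial derivative of the mean of `∂ₑh`. Rotating `∂ⱼh` in the plane of `b
j` and `e` and summing over `j` leaves the Laplacian weighted by the height. -/
theorem integral_sphere_fderiv_fderiv {h : E → ℝ} (hC : ContDiffOn ℝ 2 h (ball 0 1)) (e : E)
    {r : ℝ} (hr : r ∈ Ioo (-1 : ℝ) 1) (hr0 : r ≠ 0) :
    ∫ ζ : sphere (0 : E) 1, fderiv ℝ (fderiv ℝ h) (r • (ζ : E)) ζ e ∂(sphereMeasure E) =
      ∫ ζ : sphere (0 : E) 1, Laplacian.laplacian h (r • (ζ : E)) * ⟪e, (ζ : E)⟫_ℝ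
        ∂(sphereMeasure E) := by
  set b := stdOrthonormalBasis ℝ E
  have hD2 := continuous_smul_sphere (continuousOn_fderiv_fderiv_ball hC) hr
  have hL := continuous_smul_sphere (continuousOn_laplacian_ball hC) hr
  have hco : Continuous fun ζ : sphere (0 : E) 1 => (ζ : E) := continuous_subtype_val
  have hce : ∀ v : E, Continuous fun ζ : sphere (0 : E) 1 => ⟪v, (ζ : E)⟫_ℝ := by
    intro i; fun_prop
  have hj : ∀ j, ∫ ζ : sphere (0 : E) 1, r * fderiv ℝ (fderiv ℝ h) (r • (ζ : E))
      (⟪b j, (ζ : E)⟫_ℝ • e - ⟪e, (ζ : E)⟫_ℝ • b j) (b j) ∂(sphereMeasure E) = 0 := fun j =>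
    integral_sphere_rotation
      (fun ζ hζ => hasFDerivAt_fderiv_apply_comp_smul hC hr (b j) hζ)
      (continuousOn_fderiv_fderiv_apply_comp_smul hC hr (b j)) (b j) e
  have hsum := Finset.sum_eq_zero (s := Finset.univ) (fun j _ => hj j)
  have hc1 : ∀ j, Continuous fun ζ : sphere (0 : E) 1 => r * fderiv ℝ (fderiv ℝ h) (r • (ζ : E))
      (⟪b j, (ζ : E)⟫_ℝ • e - ⟪e, (ζ : E)⟫_ℝ • b j) (b j) := fun j =>
    continuous_const.mul ((hD2.clm_apply (((hce _).smul continuous_const).sub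
      ((hce _).smul continuous_const))).clm_apply continuous_const)
  rw [← integral_finsetSum _ (fun i _ => (hc1 i).integrable_sphere)] at hsum
  have hp : ∀ ζ : sphere (0 : E) 1, ∑ j, r * fderiv ℝ (fderiv ℝ h) (r • (ζ : E))
      (⟪b j, (ζ : E)⟫_ℝ • e - ⟪e, (ζ : E)⟫_ℝ • b j) (b j) =
      r * (fderiv ℝ (fderiv ℝ h) (r • (ζ : E)) ζ e
        - Laplacian.laplacian h (r • (ζ : E)) * ⟪e, (ζ : E)⟫_ℝ) := by
    intro ζ
    have := congrArg (fderiv ℝ (fderiv ℝ h) (r • (ζ : E)) e) (b.sum_repr' (ζ : E))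
    simp only [map_sum, map_smul, smul_eq_mul] at this
    rw [fderiv_fderiv_symm_of_contDiffOn hC (smul_sphere_mem_ball hr ζ.2), ← this,
      laplacian_eq_sum_fderiv_fderiv b, Finset.sum_mul, ← Finset.sum_sub_distrib, Finset.mul_sum]
    refine Finset.sum_congr rfl fun j _ => ?_
    simp
    left
    ring
  simp only [hp] at hsum
  have hc2 : Continuous fun ζ : sphere (0 : E) 1 =>
      Laplacian.laplacian h (r • (ζ : E)) * ⟪e, (ζ : E)⟫_ℝ := hL.mul (hce e)
  rw [integral_const_mul, integral_sub ((hD2.clm_apply hco).clm_apply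
    continuous_const).integrable_sphere hc2.integrable_sphere] at hsum
  exact sub_eq_zero.1 ((mul_eq_zero.1 hsum).resolve_left hr0)

/-- Integration by parts for `h(r ·)` along `e`. It links the mean of `∂ₑh` to the first moment `k`
and to `k'`. -/
theorem integral_sphere_first_moment {h : E → ℝ} (hC : ContDiffOn ℝ 2 h (ball 0 1)) (e : E)
    {r : ℝ} (hr : r ∈ Ioo (-1 : ℝ) 1) :
    r * ∫ ζ : sphere (0 : E) 1, fderiv ℝ h (r • (ζ : E)) e ∂(sphereMeasure E) =
      r * ∫ ζ : sphere (0 : E) 1, fderiv ℝ h (r • (ζ : E)) ζ * ⟪e, (ζ : E)⟫_ℝ ∂(sphereMeasure E) +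
      ((Module.finrank ℝ E : ℝ) - 1) *
        ∫ ζ : sphere (0 : E) 1, h (r • (ζ : E)) * ⟪e, (ζ : E)⟫_ℝ ∂(sphereMeasure E) := by
  have hD1 := continuous_smul_sphere (continuousOn_fderiv_ball hC) hr
  have hco : Continuous fun ζ : sphere (0 : E) 1 => (ζ : E) := continuous_subtype_val
  have hce : Continuous fun ζ : sphere (0 : E) 1 => ⟪e, (ζ : E)⟫_ℝ := by fun_prop
  have h1 : ContinuousOn (fun x : E => r • fderiv ℝ h (r • x)) (sphere (0 : E) 1) :=
    ((continuousOn_fderiv_ball hC).comp (by fun_prop)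
      fun x hx => smul_sphere_mem_ball hr hx).const_smul r
  have h2 := integral_sphere_tangential (fun ζ hζ => hasFDerivAt_comp_smul_left
    (fderiv_hasFDerivAt_of_contDiffOn hC (smul_sphere_mem_ball hr hζ))) h1 e
  rw [← h2, ← integral_const_mul, ← integral_const_mul, ← integral_add]
  · congr 1
    ext ζ
    simp
    ring
  · exact ((hD1.clm_apply hco).mul hce).integrable_sphere.const_mul r
  · refine Continuous.integrable_sphere (.sub ?_ (hce.mul ?_))
    · exact (hD1.clm_apply continuous_const).const_smul r
    · exact (hD1.clm_apply hco).const_smul r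

end SphericalMeans

/-! ### Radial ODEs and the gradient bounds. -/

section RadialEquations

theorem eq_apply_zero_of_hasDerivAt_zero {f f' : ℝ → ℝ}
    (hf : ∀ r ∈ Ioo (-1 : ℝ) 1, HasDerivAt f (f' r) r) (hf' : ∀ r ∈ Ioo (0 : ℝ) 1, f' r = 0)
    {r : ℝ} (hr : r ∈ Ioo (0 : ℝ) 1) : f r = f 0 := by
  obtain ⟨c, hc, hc'⟩ := exists_hasDerivAt_eq_slope f f' hr.1
    (fun x hx =>
      (hf x ⟨by linarith [hx.1], by linarith [hx.2, hr.2]⟩).continuousAt.continuousWithinAt)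
    (fun x hx => hf x ⟨by linarith [hx.1], by linarith [hx.2, hr.2]⟩)
  rw [hf' c ⟨hc.1, hc.2.trans hr.2⟩, eq_comm, div_eq_zero_iff] at hc'
  rcases hc' with h | h
  · linarith
  · linarith [hr.1]

/-- A solution of `(1 - r²) r k' = C r - N (1 + r²) k` on `(0, 1)` bounded above by `M ≥ 0` has
`C ≤ 2 N M`. -/
theorem le_of_hasDerivAt_of_bddAbove {k k' : ℝ → ℝ} {C N M : ℝ} (hN : 0 ≤ N) (hM : 0 ≤ M)
    (hk : ∀ r ∈ Ioo (0 : ℝ) 1, HasDerivAt k (k' r) r)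
    (heq : ∀ r ∈ Ioo (0 : ℝ) 1, (1 - r ^ 2) * (r * k' r) = C * r - N * (1 + r ^ 2) * k r)
    (hkM : ∀ r ∈ Ioo (0 : ℝ) 1, k r ≤ M) : C ≤ 2 * N * M := by
  by_contra! hlt
  set ε := C - 2 * N * M with hε
  have hε0 : 0 < ε := by linarith
  -- On `[1 - η, 1)` the error `N M (1 - r)²`, which comes from `1 + r² = 2 r + (1 - r)²`, is
  -- absorbed by `ε`. The `+ 1` keeps the denominator positive when `N M = 0`.
  set η := min (1 / 2) (ε / (4 * (N * M + 1))) with hη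
  have hNM : 0 ≤ N * M := mul_nonneg hN hM
  have hη0 : 0 < η := by positivity
  have hη1 : η ≤ 1 / 2 := min_le_left _ _
  have hη2 : η * (4 * (N * M + 1)) ≤ ε := by
    rw [← le_div_iff₀ (by positivity)]
    exact min_le_right _ _
  have hder : ∀ r ∈ Ico (1 - η) 1, ε / 4 / (1 - r) ≤ k' r := by
    rintro r ⟨h1, h2⟩
    have hr0 : 0 < r := by linarith
    have h3 := heq r ⟨hr0, h2⟩
    have h4 : N * (1 + r ^ 2) * k r ≤ N * (1 + r ^ 2) * M :=
      mul_le_mul_of_nonneg_left (hkM r ⟨hr0, h2⟩) (by positivity)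
    have h5 : N * M * (1 - r) ≤ ε / 4 := by
      have : N * M * (1 - r) ≤ N * M * η := mul_le_mul_of_nonneg_left (by linarith) hNM
      nlinarith
    have h6 : r * (ε / 2) ≤ r * ((1 - r ^ 2) * k' r) := by
      have : N * M * (1 - r) * (1 - r) ≤ ε / 4 * (1 - r) :=
        mul_le_mul_of_nonneg_right h5 (by linarith)
      nlinarith
    have h7 : ε / 2 ≤ (1 - r ^ 2) * k' r := le_of_mul_le_mul_left h6 hr0
    have h8 : 0 < k' r := by
      by_contra! h
      nlinarith [mul_nonneg (show (0 : ℝ) ≤ 1 - r ^ 2 by nlinarith) (neg_nonneg.2 h)]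
    rw [div_le_iff₀ (by linarith)]
    nlinarith [mul_nonneg h8.le (sq_nonneg (1 - r))]
  set r₀ := 1 - η with hr₀
  -- Integrating `k' ≥ ε / (4 (1 - r))` from `1 - η` to `1 - η exp (-T)` makes `k` grow by at least
  -- `ε T / 4`, with `T` arbitrary.
  have hT : ∀ T : ℝ, 0 < T → ε / 4 * T ≤ M - k r₀ := by
    intro T hT
    have hexp : 0 < Real.exp (-T) := Real.exp_pos _
    have hexp1 : Real.exp (-T) < 1 := by
      rw [Real.exp_lt_one_iff]
      linarith
    set r := 1 - η * Real.exp (-T) with hr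
    have hr0r : r₀ < r := by nlinarith
    have hr1 : r < 1 := by
      have := mul_pos hη0 hexp
      linarith
    have hd : ∀ x ∈ Icc r₀ r, HasDerivAt (fun x => k x + ε / 4 * Real.log (1 - x))
        (k' x + ε / 4 * (-1 / (1 - x))) x := by
      intro x hx
      have hx1 : x < 1 := hx.2.trans_lt hr1
      refine (hk x ⟨by linarith [hx.1], hx1⟩).add (HasDerivAt.const_mul _ ?_)
      exact ((hasDerivAt_id x).const_sub 1).log (by simp; linarith)
    obtain ⟨c, hc, hc'⟩ := exists_hasDerivAt_eq_slope _ _ hr0r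
      (fun x hx => (hd x hx).continuousAt.continuousWithinAt)
      (fun x hx => hd x ⟨hx.1.le, hx.2.le⟩)
    have h1 := hder c ⟨hc.1.le, hc.2.trans hr1⟩
    have h2 : 0 ≤ k' c + ε / 4 * (-1 / (1 - c)) := by
      have : ε / 4 * (-1 / (1 - c)) = -(ε / 4 / (1 - c)) := by ring
      linarith
    rw [hc', le_div_iff₀ (by linarith), zero_mul] at h2
    have h3 : Real.log (1 - r) = Real.log η - T := by
      rw [hr, sub_sub_cancel, Real.log_mul hη0.ne' hexp.ne', Real.log_exp]
      ring
    have h4 : Real.log (1 - r₀) = Real.log η := by rw [hr₀, sub_sub_cancel]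
    rw [h3, h4] at h2
    have h5 := hkM r ⟨by linarith, hr1⟩
    nlinarith
  have h1 := hkM r₀ ⟨by linarith, by linarith⟩
  have h2 := hT (4 / ε * (M - k r₀ + 1)) (by
    have : 0 < M - k r₀ + 1 := by linarith
    positivity)
  have h3 : ε / 4 * (4 / ε * (M - k r₀ + 1)) = M - k r₀ + 1 := by field_simp
  linarith

variable {E : Type*} [NormedAddCommGroup E] [InnerProductSpace ℝ E] [FiniteDimensional ℝ E]

/-- `h` is `C²` on the unit ball and solves `(1 - |x|²) Δh + 2 β x·∇h = 0` there: for `β = 0` it is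
harmonic, for `β = n - 2` hyperbolic harmonic. -/
def IsWeightedHarmonic (β : ℝ) (h : E → ℝ) : Prop :=
  ContDiffOn ℝ 2 h (ball 0 1) ∧ ∀ x ∈ ball (0 : E) 1,
    (1 - ‖x‖ ^ 2) * Laplacian.laplacian h x + 2 * β * fderiv ℝ h x x = 0

theorem IsWeightedHarmonic.laplacian_smul_sphere {β : ℝ} {h : E → ℝ} (hh : IsWeightedHarmonic β h)
    {r : ℝ} (hr : r ∈ Ioo (-1 : ℝ) 1) (ζ : sphere (0 : E) 1) :
    Laplacian.laplacian h (r • (ζ : E)) =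
      -(2 * β * r / (1 - r ^ 2)) * fderiv ℝ h (r • (ζ : E)) ζ := by
  have h1 := hh.2 _ (smul_sphere_mem_ball hr ζ.2)
  have h2 : 0 < 1 - r ^ 2 := by nlinarith [hr.1, hr.2]
  rw [norm_smul, norm_sphere_coe, mul_one, Real.norm_eq_abs, sq_abs, map_smul, smul_eq_mul] at h1
  field_simp
  linarith

variable [MeasurableSpace E] [BorelSpace E] [Nontrivial E]

/-- The derivative `m₁` of the spherical mean solves a first-order linear ODE with integrating
factor `r ^ (n - 1) (1 - r²) ^ (-β)`. The product vanishes at `r = 0`, so `m₁ = 0`. -/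
theorem IsWeightedHarmonic.mean_value {β : ℝ} {h : E → ℝ} (hh : IsWeightedHarmonic β h)
    (hE : 2 ≤ Module.finrank ℝ E) {r : ℝ} (hr : r ∈ Ioo (0 : ℝ) 1) :
    ∫ ζ : sphere (0 : E) 1, h (r • (ζ : E)) ∂(sphereMeasure E) = h 0 := by
  -- Here `N = n - 2`, so that `n - 1 = N + 1` is a positive exponent.
  obtain ⟨N, hN⟩ := Nat.exists_eq_add_of_le' hE
  have hN' : (Module.finrank ℝ E : ℝ) - 1 = N + 1 := by rw [hN]; push_cast; ring
  set m₁ : ℝ → ℝ := fun r => ∫ ζ : sphere (0 : E) 1, fderiv ℝ h (r • (ζ : E)) ζ ∂(sphereMeasure E)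
    with hm₁
  set m₂ : ℝ → ℝ := fun r => ∫ ζ : sphere (0 : E) 1,
    fderiv ℝ (fderiv ℝ h) (r • (ζ : E)) ζ ζ ∂(sphereMeasure E) with hm₂
  have hm₁d : ∀ r ∈ Ioo (-1 : ℝ) 1, HasDerivAt m₁ (m₂ r) r := fun r hr =>
    hasDerivAt_integral_fderiv_radial hh.1 hr
  have hode : ∀ r ∈ Ioo (-1 : ℝ) 1,
      r * m₂ r + (N + 1) * m₁ r = r * (-(2 * β * r / (1 - r ^ 2)) * m₁ r) := by
    intro r hr
    have h1 := integral_sphere_laplacian hh.1 hr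
    simp only [hh.laplacian_smul_sphere hr, integral_const_mul, hN'] at h1
    exact h1
  have hQ : ∀ r ∈ Ioo (-1 : ℝ) 1, HasDerivAt (fun r => r ^ (N + 1) * (1 - r ^ 2) ^ (-β) * m₁ r)
      0 r := by
    intro r hr
    have h2 : 0 < 1 - r ^ 2 := by nlinarith [hr.1, hr.2]
    have h3 : HasDerivAt (fun r : ℝ => 1 - r ^ 2) (-(2 * r)) r := by
      simpa using (hasDerivAt_pow 2 r).const_sub 1
    have h4 := ((hasDerivAt_pow (N + 1) r).mul
      (h3.rpow_const (p := -β) (Or.inl h2.ne'))).mul (hm₁d r hr)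
    refine h4.congr_deriv ?_
    have h5 := hode r hr
    rw [Real.rpow_sub_one h2.ne']
    have h6 : r * m₂ r = r * (-(2 * β * r / (1 - r ^ 2)) * m₁ r) - (N + 1) * m₁ r := by linarith
    calc _ = r ^ N * (1 - r ^ 2) ^ (-β) * ((N + 1) * m₁ r +
          2 * β * r ^ 2 / (1 - r ^ 2) * m₁ r + r * m₂ r) := by
          simp only [Pi.mul_apply, Nat.add_sub_cancel]
          push_cast
          ring
      _ = 0 := by
          rw [h6]
          ring
  have hm₁0 : ∀ r ∈ Ioo (0 : ℝ) 1, m₁ r = 0 := by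
    intro r hr
    have h1 := eq_apply_zero_of_hasDerivAt_zero hQ (fun _ _ => rfl) hr
    have h2 : 0 < 1 - r ^ 2 := by nlinarith [hr.1, hr.2]
    have h3 : 0 < r ^ (N + 1) * (1 - r ^ 2) ^ (-β) :=
      mul_pos (pow_pos hr.1 _) (Real.rpow_pos_of_pos h2 _)
    simp only [ne_eq, Nat.add_eq_zero_iff, one_ne_zero, and_false, not_false_eq_true, zero_pow,
      zero_mul] at h1
    exact (mul_eq_zero.1 h1).resolve_left h3.ne'
  have hm : ∀ r ∈ Ioo (-1 : ℝ) 1, HasDerivAt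
      (fun r => ∫ ζ : sphere (0 : E) 1, h (r • (ζ : E)) ∂(sphereMeasure E)) (m₁ r) r := by
    intro r hr
    simpa using hasDerivAt_integral_smul_sphere hh.1 (ω := fun _ => 1) continuous_const hr
  have := eq_apply_zero_of_hasDerivAt_zero hm hm₁0 hr
  simpa using this

theorem IsWeightedHarmonic.hasDerivAt_integral_fderiv {β : ℝ} {h : E → ℝ}
    (hh : IsWeightedHarmonic β h) (e : E) {r : ℝ} (hr : r ∈ Ioo (0 : ℝ) 1) :
    HasDerivAt (fun t => ∫ ζ : sphere (0 : E) 1, fderiv ℝ h (t • (ζ : E)) e ∂(sphereMeasure E))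
      (-(2 * β * r / (1 - r ^ 2)) * ∫ ζ : sphere (0 : E) 1,
        fderiv ℝ h (r • (ζ : E)) ζ * ⟪e, (ζ : E)⟫_ℝ ∂(sphereMeasure E)) r := by
  have hr' : r ∈ Ioo (-1 : ℝ) 1 := ⟨by linarith [hr.1], hr.2⟩
  have h1 := hasDerivAt_integral_fderiv_const hh.1 e hr'
  rw [integral_sphere_fderiv_fderiv hh.1 e hr' hr.1.ne'] at h1
  simp only [hh.laplacian_smul_sphere hr', mul_assoc] at h1
  rw [integral_const_mul] at h1
  simpa only [mul_assoc] using h1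

/-- Upper bounds for the first moments of a harmonic function bound its gradient at the origin. -/
theorem IsWeightedHarmonic.fderiv_le_of_harmonic {h : E → ℝ} (hh : IsWeightedHarmonic 0 h)
    (hE : 2 ≤ Module.finrank ℝ E) (e : E) {M : ℝ}
    (hM : ∀ r ∈ Ioo (0 : ℝ) 1,
      ∫ ζ : sphere (0 : E) 1, h (r • (ζ : E)) * ⟪e, (ζ : E)⟫_ℝ ∂(sphereMeasure E) ≤ M) :
    fderiv ℝ h 0 e ≤ Module.finrank ℝ E * M := by
  obtain ⟨N, hN⟩ := Nat.exists_eq_add_of_le' hE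
  have hN' : (Module.finrank ℝ E : ℝ) - 1 = N + 1 := by rw [hN]; push_cast; ring
  set k : ℝ → ℝ := fun r => ∫ ζ : sphere (0 : E) 1, h (r • (ζ : E)) * ⟪e, (ζ : E)⟫_ℝ
    ∂(sphereMeasure E) with hk
  set q : ℝ → ℝ := fun r => ∫ ζ : sphere (0 : E) 1, fderiv ℝ h (r • (ζ : E)) e
    ∂(sphereMeasure E) with hq
  set k' : ℝ → ℝ := fun r => ∫ ζ : sphere (0 : E) 1,
        fderiv ℝ h (r • (ζ : E)) ζ * ⟪e, (ζ : E)⟫_ℝ ∂(sphereMeasure E) with hk'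
  have hkd : ∀ r ∈ Ioo (-1 : ℝ) 1, HasDerivAt k (k' r) r := fun r hr =>
    hasDerivAt_integral_smul_sphere hh.1 (ω := fun x => ⟪e, x⟫_ℝ) (by fun_prop) hr
  have hq0 : q 0 = fderiv ℝ h 0 e := by simp [hq]
  -- With `β = 0` the mean of `∂ₑh` is constant in `r`.
  have hqc : ∀ r ∈ Ioo (0 : ℝ) 1, q r = fderiv ℝ h 0 e := by
    intro r hr
    rw [← hq0]
    refine eq_apply_zero_of_hasDerivAt_zero
      (fun r hr => hasDerivAt_integral_fderiv_const hh.1 e hr) (fun r hr => ?_) hr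
    have hr' : r ∈ Ioo (-1 : ℝ) 1 := ⟨by linarith [hr.1], hr.2⟩
    rw [(hasDerivAt_integral_fderiv_const hh.1 e hr').unique (hh.hasDerivAt_integral_fderiv e hr)]
    simp
  have hode : ∀ r ∈ Ioo (0 : ℝ) 1, r * fderiv ℝ h 0 e = r * k' r + (N + 1) * k r := by
    intro r hr
    have := integral_sphere_first_moment hh.1 e (r := r) ⟨by linarith [hr.1], hr.2⟩
    rw [hN'] at this
    rw [← hqc r hr]
    exact this
  have hkr : ∀ r ∈ Ioo (0 : ℝ) 1, r * fderiv ℝ h 0 e ≤ (N + 2) * M := by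
    intro r hr
    -- Integrating factor `r ^ (n - 1)`: the ODE for `k` integrates to `k(r) = r ∂ₑh(0) / n`, the
    -- constant being zero at `r = 0`.
    have h1 : ∀ r ∈ Ioo (-1 : ℝ) 1, HasDerivAt
        (fun r => r ^ (N + 1) * k r - fderiv ℝ h 0 e / (N + 2) * r ^ (N + 2))
        (r ^ N * (r * k' r + (N + 1) * k r - r * fderiv ℝ h 0 e)) r := by
      intro r hr
      refine (((hasDerivAt_pow (N + 1) r).mul (hkd r hr)).sub
        ((hasDerivAt_pow (N + 2) r).const_mul (fderiv ℝ h 0 e / (N + 2)))).congr_deriv ?_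
      have : (N : ℝ) + 2 ≠ 0 := by positivity
      simp only [Nat.add_sub_cancel, show N + 2 - 1 = N + 1 from rfl]
      push_cast
      field_simp
      ring
    have h2 := eq_apply_zero_of_hasDerivAt_zero h1
      (fun r hr => by rw [← hode r hr, sub_self, mul_zero]) hr
    have h3 : r ^ (N + 1) * (k r - fderiv ℝ h 0 e / (N + 2) * r) = 0 := by
      simp only [ne_eq, Nat.add_eq_zero_iff, one_ne_zero, and_false, not_false_eq_true, zero_pow,
        zero_mul, OfNat.ofNat_ne_zero, mul_zero, sub_zero] at h2
      linear_combination h2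
    have h4 := (mul_eq_zero.1 h3).resolve_left (pow_pos hr.1 _).ne'
    have h5 := hM r hr
    have h6 : (0 : ℝ) < N + 2 := by positivity
    have h7 : fderiv ℝ h 0 e / (N + 2) * r = k r := by linarith
    rw [div_mul_eq_mul_div, div_eq_iff h6.ne'] at h7
    calc r * fderiv ℝ h 0 e = k r * (N + 2) := by linarith
      _ ≤ M * (N + 2) := mul_le_mul_of_nonneg_right h5 h6.le
      _ = _ := mul_comm _ _
  have hlim : Tendsto (fun r : ℝ => r * fderiv ℝ h 0 e) (𝓝[<] 1) (𝓝 (1 * fderiv ℝ h 0 e)) :=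
    (Continuous.tendsto (by fun_prop) 1).mono_left nhdsWithin_le_nhds
  rw [one_mul] at hlim
  have hfin : (Module.finrank ℝ E : ℝ) = N + 2 := by rw [hN]; push_cast; ring
  rw [hfin]
  refine le_of_tendsto hlim ?_
  filter_upwards [Ioo_mem_nhdsLT (show (0 : ℝ) < 1 by norm_num)] with r hr
  exact hkr r hr

/-- Upper bounds for the first moments of a hyperbolic harmonic function bound its gradient at the
origin. -/
theorem IsWeightedHarmonic.fderiv_le_of_hyperbolic {h : E → ℝ}
    (hh : IsWeightedHarmonic ((Module.finrank ℝ E : ℝ) - 2) h) (hE : 2 ≤ Module.finrank ℝ E)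
    (e : E) {M : ℝ} (hM0 : 0 ≤ M)
    (hM : ∀ r ∈ Ioo (0 : ℝ) 1,
      ∫ ζ : sphere (0 : E) 1, h (r • (ζ : E)) * ⟪e, (ζ : E)⟫_ℝ ∂(sphereMeasure E) ≤ M) :
    fderiv ℝ h 0 e ≤ 2 * ((Module.finrank ℝ E : ℝ) - 1) * M := by
  set n : ℝ := (Module.finrank ℝ E : ℝ) with hn
  have hn2 : 2 ≤ n := by rw [hn]; exact_mod_cast hE
  set k : ℝ → ℝ := fun r => ∫ ζ : sphere (0 : E) 1, h (r • (ζ : E)) * ⟪e, (ζ : E)⟫_ℝ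
    ∂(sphereMeasure E) with hk
  set q : ℝ → ℝ := fun r => ∫ ζ : sphere (0 : E) 1, fderiv ℝ h (r • (ζ : E)) e
    ∂(sphereMeasure E) with hq
  set k' : ℝ → ℝ := fun r => ∫ ζ : sphere (0 : E) 1,
        fderiv ℝ h (r • (ζ : E)) ζ * ⟪e, (ζ : E)⟫_ℝ ∂(sphereMeasure E) with hk'
  set q' : ℝ → ℝ := fun r => ∫ ζ : sphere (0 : E) 1,
    fderiv ℝ (fderiv ℝ h) (r • (ζ : E)) ζ e ∂(sphereMeasure E) with hq'
  have hkd : ∀ r ∈ Ioo (-1 : ℝ) 1, HasDerivAt k (k' r) r := fun r hr =>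
    hasDerivAt_integral_smul_sphere hh.1 (ω := fun x => ⟪e, x⟫_ℝ) (by fun_prop) hr
  have hqd : ∀ r ∈ Ioo (-1 : ℝ) 1, HasDerivAt q (q' r) r := fun r hr =>
    hasDerivAt_integral_fderiv_const hh.1 e hr
  have hq0 : q 0 = fderiv ℝ h 0 e := by simp [hq]
  have hqk : ∀ r ∈ Ioo (0 : ℝ) 1, r * q r = r * k' r + (n - 1) * k r := fun r hr =>
    integral_sphere_first_moment hh.1 e (r := r) ⟨by linarith [hr.1], hr.2⟩
  have hqk' : ∀ r ∈ Ioo (0 : ℝ) 1, (1 - r ^ 2) * q' r = -(2 * (n - 2) * r) * k' r := by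
    intro r hr
    have hr' : r ∈ Ioo (-1 : ℝ) 1 := ⟨by linarith [hr.1], hr.2⟩
    have h2 : 0 < 1 - r ^ 2 := by nlinarith [hr.1, hr.2]
    have h3 : q' r = -(2 * (n - 2) * r / (1 - r ^ 2)) * k' r :=
      (hqd r hr').unique (hh.hasDerivAt_integral_fderiv e hr)
    rw [h3]
    field_simp
  -- A first integral: the weighted equation for `q'` and the first-moment identity combine to a
  -- zero derivative. Eliminating `q` then leaves the ODE for `k` alone.
  have hJ : ∀ r ∈ Ioo (0 : ℝ) 1,
      (1 - r ^ 2) * q r + 2 * (n - 1) * r * k r = fderiv ℝ h 0 e := by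
    intro r hr
    have h1 : ∀ r ∈ Ioo (-1 : ℝ) 1, HasDerivAt
        (fun r => (1 - r ^ 2) * q r + 2 * (n - 1) * r * k r)
        (-(2 * r) * q r + (1 - r ^ 2) * q' r + (2 * (n - 1) * k r + 2 * (n - 1) * r * k' r)) r := by
      intro r hr
      have h3 : HasDerivAt (fun r : ℝ => 1 - r ^ 2) (-(2 * r)) r := by
        simpa using (hasDerivAt_pow 2 r).const_sub 1
      have h4 : HasDerivAt (fun r : ℝ => 2 * (n - 1) * r) (2 * (n - 1)) r := by
        simpa using (hasDerivAt_id r).const_mul (2 * (n - 1))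
      exact (h3.mul (hqd r hr)).add (h4.mul (hkd r hr))
    have h2 := eq_apply_zero_of_hasDerivAt_zero h1 (fun r hr => by
      have h3 := hqk r hr
      have h4 := hqk' r hr
      linear_combination h4 - 2 * h3) hr
    simpa [hq0] using h2
  refine le_of_hasDerivAt_of_bddAbove (N := n - 1) (by linarith) hM0
    (fun r hr => hkd r ⟨by linarith [hr.1], hr.2⟩) (fun r hr => ?_) hM
  have h1 := hJ r hr
  have h2 := hqk r hr
  linear_combination r * h1 - (1 - r ^ 2) * h2

/-- The first moments of a bounded function with given mean. -/
theorem integral_sphere_mul_inner_le {φ : sphere (0 : E) 1 → ℝ} (hφ : Continuous φ)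
    (hφ1 : ∀ ζ, |φ ζ| ≤ 1) {a : ℝ} (ha : ∫ ζ, φ ζ ∂(sphereMeasure E) = a) (e : E) (t : ℝ) :
    ∫ ζ : sphere (0 : E) 1, φ ζ * ⟪e, (ζ : E)⟫_ℝ ∂(sphereMeasure E) ≤
      ∫ ζ : sphere (0 : E) 1, |⟪e, (ζ : E)⟫_ℝ - t| ∂(sphereMeasure E) + t * a := by
  rw [← ha, ← integral_const_mul, ← integral_add (Continuous.integrable_sphere (by fun_prop))
    (Continuous.integrable_sphere (by fun_prop))]
  refine integral_mono (Continuous.integrable_sphere (by fun_prop))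
    (Continuous.integrable_sphere (by fun_prop)) fun ζ => ?_
  have h1 : φ ζ * (⟪e, (ζ : E)⟫_ℝ - t) ≤ |⟪e, (ζ : E)⟫_ℝ - t| := by
    calc _ ≤ |φ ζ * (⟪e, (ζ : E)⟫_ℝ - t)| := le_abs_self _
      _ = |φ ζ| * |⟪e, (ζ : E)⟫_ℝ - t| := abs_mul _ _
      _ ≤ 1 * |⟪e, (ζ : E)⟫_ℝ - t| := mul_le_mul_of_nonneg_right (hφ1 ζ) (abs_nonneg _)
      _ = _ := one_mul _
  simp only
  linarith

theorem IsWeightedHarmonic.exists_first_moment_bound {β : ℝ} {h : E → ℝ}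
    (hh : IsWeightedHarmonic β h) (hE : 3 ≤ Module.finrank ℝ E)
    (hmaps : MapsTo h (ball 0 1) (Ioo (-1) 1)) {e : E} (he : ‖e‖ = 1) :
    ∃ M, 0 ≤ M ∧ (∀ r ∈ Ioo (0 : ℝ) 1, ∫ ζ : sphere (0 : E) 1, h (r • (ζ : E)) * ⟪e, (ζ : E)⟫_ℝ
      ∂(sphereMeasure E) ≤ M) ∧ M ≤ (1 - |h 0| ^ 2) / 2 ∧
      (4 ≤ Module.finrank ℝ E → M < (1 - |h 0| ^ 2) / 2) := by
  have h0 := hmaps (mem_ball_self one_pos : (0 : E) ∈ ball 0 1)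
  have ht : |(-h 0)| < 1 := by rw [abs_neg]; exact abs_lt.2 h0
  have hpos : 0 < (1 - |h 0| ^ 2) / 2 := by
    rw [sq_abs]
    nlinarith [h0.1, h0.2]
  -- The choice `t = -h 0` turns `(1 + t²) / 2 + t h(0)` into `(1 - h(0)²) / 2`. The maximum with
  -- `0` supplies the sign needed in the hyperbolic case and keeps strictness, since this bound is
  -- positive.
  refine ⟨max 0 (∫ ζ : sphere (0 : E) 1, |⟪e, (ζ : E)⟫_ℝ - (-h 0)| ∂(sphereMeasure E) + -h 0 * h 0),
    le_max_left _ _, fun r hr => le_max_of_le_right ?_, max_le hpos.le ?_,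
    fun hE4 => max_lt hpos ?_⟩
  · have hr' : r ∈ Ioo (-1 : ℝ) 1 := ⟨by linarith [hr.1], hr.2⟩
    refine integral_sphere_mul_inner_le (continuous_smul_sphere hh.1.continuousOn hr')
      (fun ζ => (abs_lt.2 (hmaps (smul_sphere_mem_ball hr' ζ.2))).le)
      (hh.mean_value (by omega) hr) e _
  · have := integral_sphere_abs_inner_sub_le hE ht he
    rw [sq_abs]
    linarith
  · have := integral_sphere_abs_inner_sub_lt hE4 ht he
    rw [sq_abs]
    linarith

end RadialEquations

/-! ### Sharpness: rescaling positive solutions, and Poisson kernels. -/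

section Extremals

theorem norm_sub_sq_pos {E : Type*} [NormedAddCommGroup E] {p x : E} (hp : 1 < ‖p‖)
    (hx : x ∈ ball (0 : E) 1) :
    0 < ‖x - p‖ ^ 2 := by
  rw [mem_ball_zero_iff] at hx
  have : x - p ≠ 0 := fun h => by
    rw [sub_eq_zero.1 h] at hx
    linarith
  have := norm_pos_iff.2 this
  positivity

variable {E : Type*} [NormedAddCommGroup E] [InnerProductSpace ℝ E]

theorem hasFDerivAt_norm_sub_sq_rpow {p x : E} (hx : 0 < ‖x - p‖ ^ 2) (m : ℝ) :
    HasFDerivAt (fun y : E => (‖y - p‖ ^ 2) ^ m)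
      ((2 * m * (‖x - p‖ ^ 2) ^ (m - 1)) • (innerSL ℝ x - innerSL ℝ p)) x := by
  have h1 : HasFDerivAt (fun y : E => ‖y - p‖ ^ 2) (2 • innerSL ℝ (x - p)) x :=
    ((hasFDerivAt_id (𝕜 := ℝ) x).sub_const p).norm_sq
  refine (h1.rpow_const (p := m) (Or.inl hx.ne')).congr_fderiv ?_
  ext v
  simp
  ring

theorem hasFDerivAt_sub_norm_sq (c : ℝ) (x : E) :
    HasFDerivAt (fun y : E => c - ‖y‖ ^ 2) (-(2 • innerSL ℝ x)) x :=
  (hasStrictFDerivAt_norm_sq x).hasFDerivAt.const_sub c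

/-- The Poisson kernel with pole at `p`, up to a constant factor. -/
noncomputable def ballPoissonKernel (p x : E) : ℝ :=
  (‖p‖ ^ 2 - ‖x‖ ^ 2) * (‖x - p‖ ^ 2) ^ (-(Module.finrank ℝ E : ℝ) / 2)

theorem hasFDerivAt_ballPoissonKernel {p x : E} (hx : 0 < ‖x - p‖ ^ 2) :
    HasFDerivAt (ballPoissonKernel p)
      ((-2 * (‖x - p‖ ^ 2) ^ (-(Module.finrank ℝ E : ℝ) / 2) - Module.finrank ℝ E *
        ((‖p‖ ^ 2 - ‖x‖ ^ 2) * (‖x - p‖ ^ 2) ^ (-(Module.finrank ℝ E : ℝ) / 2 - 1))) • innerSL ℝ x +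
      (Module.finrank ℝ E *
        ((‖p‖ ^ 2 - ‖x‖ ^ 2) * (‖x - p‖ ^ 2) ^ (-(Module.finrank ℝ E : ℝ) / 2 - 1))) • innerSL ℝ p)
      x := by
  refine ((hasFDerivAt_sub_norm_sq (‖p‖ ^ 2) x).mul
    (hasFDerivAt_norm_sub_sq_rpow hx _)).congr_fderiv ?_
  ext v
  simp
  ring

variable [FiniteDimensional ℝ E]

/-- Trace of the derivative of a gradient field `a(x) x + b(x) p`. The gradients of both extremal
families have this form. -/
theorem laplacian_of_hasFDerivAt {u a b : E → ℝ} {p : E} {s : Set E} (hs : IsOpen s)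
    (hu : ∀ x ∈ s, HasFDerivAt u (a x • innerSL ℝ x + b x • innerSL ℝ p) x)
    {x : E} (hx : x ∈ s) {a' b' : E →L[ℝ] ℝ} (ha : HasFDerivAt a a' x) (hb : HasFDerivAt b b' x) :
    Laplacian.laplacian u x = Module.finrank ℝ E * a x + a' x + b' p := by
  have h1 : fderiv ℝ u =ᶠ[𝓝 x] fun y => a y • innerSL ℝ y + b y • innerSL ℝ p := by
    filter_upwards [hs.mem_nhds hx] with y hy
    exact (hu y hy).fderiv
  have hJ : HasFDerivAt (fun y : E => (innerSL ℝ y : E →L[ℝ] ℝ))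
      ((isBoundedBilinearMap_inner (𝕜 := ℝ) (E := E)).toContinuousLinearMap) x :=
    ((isBoundedBilinearMap_inner (𝕜 := ℝ) (E := E)).toContinuousLinearMap).hasFDerivAt
  have h2 := (ha.smul hJ).add (hb.smul_const (innerSL ℝ p))
  have h3 := (h2.congr_of_eventuallyEq h1).fderiv
  rw [laplacian_eq_sum_fderiv_fderiv (stdOrthonormalBasis ℝ E), h3]
  set v := stdOrthonormalBasis ℝ E
  have h4 : ∀ l : E →L[ℝ] ℝ, ∀ z : E, ∑ i, l (v i) * ⟪z, v i⟫_ℝ = l z := by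
    intro l z
    have := congrArg l (v.sum_repr' z)
    simp only [map_sum, map_smul, smul_eq_mul] at this
    rw [← this]
    exact Finset.sum_congr rfl fun i _ => by rw [mul_comm, real_inner_comm]
  have h5 : ∀ i, ((isBoundedBilinearMap_inner (𝕜 := ℝ) (E := E)).toContinuousLinearMap (v i)) (v i)
      = 1 := by
    intro i
    change ⟪v i, v i⟫_ℝ = 1
    simp
  simp [h5, Finset.sum_add_distrib, h4]

theorem IsWeightedHarmonic.const_add_mul {β : ℝ} {u : E → ℝ} (hu : IsWeightedHarmonic β u)
    (c l : ℝ) : IsWeightedHarmonic β (fun x => c + l * u x) := by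
  refine ⟨contDiffOn_const.add (contDiffOn_const.mul hu.1), fun x hx => ?_⟩
  have h1 : ContDiffAt ℝ 2 u x := hu.1.contDiffAt (isOpen_ball.mem_nhds hx)
  have h2 : Laplacian.laplacian (fun x => c + l * u x) x = l * Laplacian.laplacian u x := by
    have h3 : (fun x => c + l * u x) = (fun _ => c) + l • u := by
      ext y
      simp
    rw [h3, ContDiffAt.laplacian_add contDiffAt_const (f₂ := l • u) (h1.const_smul l),
      laplacian_smul l h1]
    simp
  have h4 : fderiv ℝ (fun x => c + l * u x) x = l • fderiv ℝ u x :=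
    (((fderiv_hasFDerivAt_of_contDiffOn hu.1 hx).const_mul l).const_add c).fderiv
  rw [h2, h4]
  simp only [_root_.smul_apply, smul_eq_mul]
  linear_combination l * hu.2 x hx

theorem norm_gradient (u : E → ℝ) (x : E) : ‖gradient u x‖ = ‖fderiv ℝ u x‖ := by
  simp [gradient]

/-- A positive bounded solution with large logarithmic gradient at the origin yields, close to the
constant `-1`, a solution with values in `(-1, 1)`. -/
theorem IsWeightedHarmonic.exists_gradient_gt {β : ℝ} {u : E → ℝ} (hu : IsWeightedHarmonic β u)
    {B : ℝ} (hpos : ∀ x ∈ ball (0 : E) 1, 0 < u x) (hB : ∀ x ∈ ball (0 : E) 1, u x ≤ B)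
    {e : E} (he : ‖e‖ = 1) {c : ℝ} (hc : 0 < c) (hgrad : 2 * c * u 0 ≤ fderiv ℝ u 0 e) :
    ∃ h : E → ℝ, IsWeightedHarmonic β h ∧ MapsTo h (ball 0 1) (Ioo (-1) 1) ∧
      c * (1 - |h 0| ^ 2) < ‖gradient h 0‖ := by
  have h0 : (0 : E) ∈ ball (0 : E) 1 := mem_ball_self one_pos
  have hB0 : 0 < B := (hpos 0 h0).trans_le (hB 0 h0)
  have hBi : 0 < B⁻¹ := inv_pos.2 hB0
  refine ⟨fun x => -1 + B⁻¹ * u x, hu.const_add_mul _ _, fun x hx => ⟨?_, ?_⟩, ?_⟩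
  · have := mul_pos hBi (hpos x hx)
    linarith
  · have := mul_le_mul_of_nonneg_left (hB x hx) hBi.le
    rw [inv_mul_cancel₀ hB0.ne'] at this
    linarith
  · have h4 : fderiv ℝ (fun x => -1 + B⁻¹ * u x) 0 = B⁻¹ • fderiv ℝ u 0 :=
      (((fderiv_hasFDerivAt_of_contDiffOn hu.1 h0).const_mul B⁻¹).const_add (-1)).fderiv
    have h5 : B⁻¹ * fderiv ℝ u 0 e ≤ ‖fderiv ℝ (fun x => -1 + B⁻¹ * u x) 0‖ := by
      have := (fderiv ℝ (fun x => -1 + B⁻¹ * u x) 0).le_opNorm e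
      rw [he, mul_one, h4] at this
      rw [h4]
      exact (le_abs_self _).trans this
    rw [norm_gradient, sq_abs]
    refine lt_of_lt_of_le ?_ h5
    have h6 := mul_le_mul_of_nonneg_left hgrad hBi.le
    have h7 : 0 < B⁻¹ * u 0 := mul_pos hBi (hpos 0 h0)
    -- With `v = u(0) / B`, `1 - h(0)² = 2 v - v²`; the term `c v²` is what makes the inequality
    -- strict.
    have h8 : 0 < c * (B⁻¹ * u 0) ^ 2 := by positivity
    nlinarith

theorem isWeightedHarmonic_ballPoissonKernel {p : E} (hp : 1 < ‖p‖) :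
    IsWeightedHarmonic 0 (ballPoissonKernel p) := by
  refine ⟨fun x hx => ?_, fun x hx => ?_⟩
  · refine (ContDiffAt.mul ?_ ?_).contDiffWithinAt
    · exact contDiffAt_const.sub (contDiff_norm_sq ℝ).contDiffAt
    · exact ContDiffAt.rpow_const_of_ne
        ((contDiff_norm_sq ℝ).comp (contDiff_id.sub contDiff_const)).contDiffAt
        (norm_sub_sq_pos hp hx).ne'
  · have hA := norm_sub_sq_pos hp hx
    have hW := hasFDerivAt_sub_norm_sq (‖p‖ ^ 2) x
    have hWB := (hW.mul (hasFDerivAt_norm_sub_sq_rpow hA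
      (-(Module.finrank ℝ E : ℝ) / 2 - 1))).const_mul (Module.finrank ℝ E : ℝ)
    have hψ := (hasFDerivAt_norm_sub_sq_rpow hA (-(Module.finrank ℝ E : ℝ) / 2)).const_mul (-2)
    have h1 := laplacian_of_hasFDerivAt isOpen_ball
      (fun y hy => hasFDerivAt_ballPoissonKernel (norm_sub_sq_pos hp hy)) hx (hψ.sub hWB) hWB
    have hA' : ‖x - p‖ ≠ 0 := fun h => by simp [h] at hA
    have h2 : Laplacian.laplacian (ballPoissonKernel p) x = 0 := by
      rw [h1]
      -- All powers of `‖x - p‖²` are reduced to the lowest one, after which harmonicity is a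
      -- polynomial identity.
      have e1 : (‖x - p‖ ^ 2) ^ (-(Module.finrank ℝ E : ℝ) / 2) =
          (‖x - p‖ ^ 2) ^ (-(Module.finrank ℝ E : ℝ) / 2 - 1 - 1) * (‖x - p‖ ^ 2) ^ 2 := by
        rw [Real.rpow_sub_one hA.ne', Real.rpow_sub_one hA.ne']
        field_simp
      have e2 : (‖x - p‖ ^ 2) ^ (-(Module.finrank ℝ E : ℝ) / 2 - 1) =
          (‖x - p‖ ^ 2) ^ (-(Module.finrank ℝ E : ℝ) / 2 - 1 - 1) * ‖x - p‖ ^ 2 := by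
        rw [Real.rpow_sub_one hA.ne' (-(Module.finrank ℝ E : ℝ) / 2 - 1)]
        field_simp
      rw [e1, e2]
      generalize (‖x - p‖ ^ 2) ^ (-(Module.finrank ℝ E : ℝ) / 2 - 1 - 1) = G
      have e3 : ‖x - p‖ ^ 2 = ‖x‖ ^ 2 - 2 * ⟪x, p⟫_ℝ + ‖p‖ ^ 2 := norm_sub_sq_real x p
      simp [real_inner_comm x p]
      rw [e3]
      ring
    rw [h2]
    ring

theorem exists_harmonic_gradient_gt (hE : 1 ≤ Module.finrank ℝ E) {c : ℝ}
    (hc : c < (Module.finrank ℝ E : ℝ) / 2) {e : E} (he : ‖e‖ = 1) :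
    ∃ h : E → ℝ, IsWeightedHarmonic 0 h ∧ MapsTo h (ball 0 1) (Ioo (-1) 1) ∧
      c * (1 - |h 0| ^ 2) < ‖gradient h 0‖ := by
  set n : ℝ := (Module.finrank ℝ E : ℝ) with hn
  have hn1 : 1 ≤ n := by rw [hn]; exact_mod_cast hE
  suffices H : ∀ c : ℝ, 0 < c → c < n / 2 →
      ∃ h : E → ℝ, IsWeightedHarmonic 0 h ∧ MapsTo h (ball 0 1) (Ioo (-1) 1) ∧
        c * (1 - |h 0| ^ 2) < ‖gradient h 0‖ by
    rcases lt_or_ge 0 c with h | h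
    · exact H c h hc
    · obtain ⟨u, h1, h2, h3⟩ := H (n / 4) (by linarith) (by linarith)
      refine ⟨u, h1, h2, lt_of_le_of_lt ?_ h3⟩
      have h4 := h2 (mem_ball_self one_pos : (0 : E) ∈ ball 0 1)
      refine mul_le_mul_of_nonneg_right (by linarith) ?_
      rw [sq_abs]
      nlinarith [h4.1, h4.2]
  clear hc c
  intro c hc0 hc
  -- At the origin the kernel with pole `ρ e` has logarithmic derivative `n / ρ` along `e`; this `ρ`
  -- makes it exactly `2 c`, and `c < n / 2` puts the pole outside the closed ball.
  set ρ : ℝ := n / (2 * c) with hρ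
  have hρ1 : 1 < ρ := by
    rw [hρ, lt_div_iff₀ (by positivity)]
    linarith
  have hρ0 : 0 < ρ := by linarith
  have hpn : ‖ρ • e‖ = ρ := by rw [norm_smul, he, mul_one, Real.norm_of_nonneg hρ0.le]
  have hp : 1 < ‖ρ • e‖ := by rw [hpn]; exact hρ1
  refine (isWeightedHarmonic_ballPoissonKernel hp).exists_gradient_gt (e := e)
    (B := ρ ^ 2 * ((ρ - 1) ^ 2) ^ (-n / 2)) ?_ ?_ he hc0 ?_
  · intro x hx
    have h1 := norm_sub_sq_pos hp hx
    rw [mem_ball_zero_iff] at hx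
    refine mul_pos ?_ (Real.rpow_pos_of_pos h1 _)
    rw [hpn]
    nlinarith [norm_nonneg x]
  · intro x hx
    have h1 := norm_sub_sq_pos hp hx
    rw [mem_ball_zero_iff] at hx
    have h2 : (ρ - 1) ^ 2 ≤ ‖x - ρ • e‖ ^ 2 := by
      have := norm_sub_norm_le (ρ • e) x
      rw [hpn, norm_sub_rev] at this
      exact pow_le_pow_left₀ (by linarith) (by linarith) 2
    refine mul_le_mul ?_ ?_ (Real.rpow_nonneg h1.le _) (by positivity)
    · rw [hpn]
      nlinarith [norm_nonneg x]
    · refine Real.rpow_le_rpow_of_nonpos (by nlinarith) h2 ?_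
      rw [← hn]
      linarith
  · have h0 : (0 : E) ∈ ball (0 : E) 1 := mem_ball_self one_pos
    have h1 := norm_sub_sq_pos hp h0
    rw [(hasFDerivAt_ballPoissonKernel h1).fderiv, Real.rpow_sub_one h1.ne']
    have h2 : ⟪ρ • e, e⟫_ℝ = ρ := by rw [inner_smul_left]; simp [he]
    simp only [ballPoissonKernel, _root_.add_apply, _root_.smul_apply,
      innerSL_apply_apply, inner_zero_left, h2, norm_zero, zero_sub, norm_neg, hpn, smul_eq_mul,
      ← hn]
    have h3 : 2 * c * ρ = n := by rw [hρ]; field_simp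
    refine le_of_eq ?_
    field_simp
    rw [← h3]
    ring

end Extremals

/-! ### Sharpness in the hyperbolic case: functions of the distance to a hyperplane. -/

section HyperbolicExtremals

/-- The primitive of `(1 + t²) ^ (-ν / 2)` that vanishes at `-∞`. -/
noncomputable def japanesePrimitive (ν y : ℝ) : ℝ := ∫ t in Iic y, (1 + t ^ 2) ^ (-ν / 2)

theorem continuous_japanese (m : ℝ) : Continuous fun t : ℝ => (1 + t ^ 2) ^ m :=
  Continuous.rpow_const (by fun_prop) fun t => Or.inl (by positivity)

theorem integrable_japanese {ν : ℝ} (hν : 1 < ν) :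
    Integrable fun t : ℝ => (1 + t ^ 2) ^ (-ν / 2) := by
  have := integrable_rpow_neg_one_add_norm_sq (E := ℝ) (μ := volume) (r := ν) (by simpa using hν)
  simpa using this

theorem hasDerivAt_japanesePrimitive {ν : ℝ} (hν : 1 < ν) (y : ℝ) :
    HasDerivAt (japanesePrimitive ν) ((1 + y ^ 2) ^ (-ν / 2)) y := by
  have h1 : japanesePrimitive ν = fun y =>
      japanesePrimitive ν 0 + ∫ t in (0 : ℝ)..y, (1 + t ^ 2) ^ (-ν / 2) := by
    ext y
    have := intervalIntegral.integral_Iic_sub_Iic (a := 0) (b := y) (μ := volume)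
      (integrable_japanese hν).integrableOn (integrable_japanese hν).integrableOn
    rw [← this, japanesePrimitive, japanesePrimitive]
    ring
  rw [h1]
  exact ((continuous_japanese (-ν / 2)).integral_hasStrictDerivAt 0 y).hasDerivAt.const_add _

theorem japanesePrimitive_pos {ν : ℝ} (hν : 1 < ν) (y : ℝ) : 0 < japanesePrimitive ν y := by
  have hpos : ∀ t : ℝ, 0 < (1 + t ^ 2) ^ (-ν / 2) := fun t => Real.rpow_pos_of_pos (by positivity) _
  rw [japanesePrimitive, integral_pos_iff_support_of_nonneg (fun t => (hpos t).le)
    (integrable_japanese hν).integrableOn]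
  have : (Function.support fun t : ℝ => (1 + t ^ 2) ^ (-ν / 2)) = univ :=
    eq_univ_of_forall fun t => (hpos t).ne'
  rw [this]
  simp

theorem japanesePrimitive_le {ν : ℝ} (hν : 1 < ν) (y : ℝ) :
    japanesePrimitive ν y ≤ ∫ t : ℝ, (1 + t ^ 2) ^ (-ν / 2) :=
  setIntegral_le_integral (integrable_japanese hν)
    (Eventually.of_forall fun t => Real.rpow_nonneg (by positivity) _)

/-- Compare `(1 + t²) ^ (-ν / 2)` with `t ^ (-ν)` on the tail; this bounds the extremal at the
origin from above. -/
theorem japanesePrimitive_neg_le {ν : ℝ} (hν : 1 < ν) {a : ℝ} (ha : 0 < a) :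
    japanesePrimitive ν (-a) ≤ a ^ (1 - ν) / (ν - 1) := by
  have h1 : japanesePrimitive ν (-a) = ∫ t in Ioi a, (1 + t ^ 2) ^ (-ν / 2) := by
    have := integral_comp_neg_Iic (-a) (fun t : ℝ => (1 + t ^ 2) ^ (-ν / 2))
    simpa [japanesePrimitive] using this
  have h2 := integral_Ioi_rpow_of_lt (a := -ν) (by linarith) ha
  have h3 : a ^ (1 - ν) / (ν - 1) = ∫ t in Ioi a, t ^ (-ν) := by
    rw [h2, show -ν + 1 = 1 - ν by ring, ← neg_sub ν 1, div_neg, neg_div, neg_neg]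
  rw [h1, h3]
  refine setIntegral_mono_on (integrable_japanese hν).integrableOn
    (integrableOn_Ioi_rpow_of_lt (by linarith) ha) measurableSet_Ioi fun t ht => ?_
  have ht0 : 0 < t := ha.trans ht
  have h4 : t ^ (-ν) = (t ^ 2) ^ (-ν / 2) := by
    rw [← Real.rpow_natCast, ← Real.rpow_mul ht0.le]
    congr 1
    push_cast
    ring
  rw [h4]
  exact Real.rpow_le_rpow_of_nonpos (by positivity) (by linarith) (by linarith)

theorem contDiff_japanesePrimitive {ν : ℝ} (hν : 1 < ν) : ContDiff ℝ 2 (japanesePrimitive ν) := by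
  have h1 : deriv (japanesePrimitive ν) = fun t : ℝ => (1 + t ^ 2) ^ (-ν / 2) :=
    funext fun y => (hasDerivAt_japanesePrimitive hν y).deriv
  rw [show (2 : WithTop ℕ∞) = 1 + 1 by norm_num, contDiff_succ_iff_deriv]
  refine ⟨fun y => (hasDerivAt_japanesePrimitive hν y).differentiableAt, by simp, ?_⟩
  rw [h1]
  exact ContDiff.rpow_const_of_ne (by fun_prop) fun t => by positivity

theorem one_sub_norm_sq_pos {E : Type*} [NormedAddCommGroup E] {x : E}
    (hx : x ∈ ball (0 : E) 1) : 0 < 1 - ‖x‖ ^ 2 := by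
  rw [mem_ball_zero_iff] at hx
  nlinarith [norm_nonneg x]

variable {E : Type*} [NormedAddCommGroup E] [InnerProductSpace ℝ E]

/-- The hyperbolic sine of the signed hyperbolic distance to a hyperplane of the unit ball that is
orthogonal to the axis `e`. -/
noncomputable def sinhDist (a : ℝ) (e x : E) : ℝ :=
  (2 * √(1 + a ^ 2) * ⟪e, x⟫_ℝ - a * (1 + ‖x‖ ^ 2)) * (1 - ‖x‖ ^ 2)⁻¹

theorem hasFDerivAt_one_sub_norm_sq_inv {x : E} (hx : x ∈ ball (0 : E) 1) :
    HasFDerivAt (fun y : E => (1 - ‖y‖ ^ 2)⁻¹) ((2 * (1 - ‖x‖ ^ 2)⁻¹ ^ 2) • innerSL ℝ x) x := by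
  refine ((hasDerivAt_inv (one_sub_norm_sq_pos hx).ne').comp_hasFDerivAt x
    (hasFDerivAt_sub_norm_sq 1 x)).congr_fderiv ?_
  ext v
  simp
  ring

theorem hasFDerivAt_sinhDist (a : ℝ) (e : E) {x : E} (hx : x ∈ ball (0 : E) 1) :
    HasFDerivAt (sinhDist a e) ((2 * (sinhDist a e x - a) * (1 - ‖x‖ ^ 2)⁻¹) • innerSL ℝ x +
      (2 * √(1 + a ^ 2) * (1 - ‖x‖ ^ 2)⁻¹) • innerSL ℝ e) x := by
  have h1 : HasFDerivAt (fun y : E => 2 * √(1 + a ^ 2) * ⟪e, y⟫_ℝ - a * (1 + ‖y‖ ^ 2))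
      ((2 * √(1 + a ^ 2)) • innerSL ℝ e - a • (2 • innerSL ℝ x)) x :=
    ((innerSL ℝ e).hasFDerivAt.const_mul _).sub
      (((hasStrictFDerivAt_norm_sq x).hasFDerivAt.const_add 1).const_mul a)
  refine (h1.mul (hasFDerivAt_one_sub_norm_sq_inv hx)).congr_fderiv ?_
  ext v
  simp [sinhDist, -inv_pow]
  ring

theorem contDiffOn_sinhDist (a : ℝ) (e : E) : ContDiffOn ℝ 2 (sinhDist a e) (ball 0 1) := by
  intro x hx
  have h1 : ContDiff ℝ 2 fun y : E => ‖y‖ ^ 2 := contDiff_norm_sq ℝ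
  have h2 : ContDiff ℝ 2 fun y : E => ⟪e, y⟫_ℝ := (innerSL ℝ e).contDiff
  have h3 : ContDiffAt ℝ 2 (fun y : E => (1 - ‖y‖ ^ 2)⁻¹) x :=
    (contDiff_const.sub h1).contDiffAt.inv (one_sub_norm_sq_pos hx).ne'
  have h4 : ContDiffAt ℝ 2
      (fun y : E => 2 * √(1 + a ^ 2) * ⟪e, y⟫_ℝ - a * (1 + ‖y‖ ^ 2)) x :=
    ((contDiff_const.mul h2).sub (contDiff_const.mul (contDiff_const.add h1))).contDiffAt
  exact (h4.mul h3).contDiffWithinAt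

variable [FiniteDimensional ℝ E]

/-- For the hyperbolic metric of curvature `-1`, `w = sinhDist a e` satisfies `Δw = n w` and `|∇w|²
= 1 + w²`. So `Φ(w)` is harmonic when `(1 + w²) Φ'' + n w Φ' = 0`, that is for `Φ'` proportional to
`(1 + w²) ^ (-n / 2)`. -/
theorem isWeightedHarmonic_japanesePrimitive_sinhDist (hE : 2 ≤ Module.finrank ℝ E) (a : ℝ)
    {e : E} (he : ‖e‖ = 1) :
    IsWeightedHarmonic ((Module.finrank ℝ E : ℝ) - 2)
      (fun x => japanesePrimitive (Module.finrank ℝ E) (sinhDist a e x)) := by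
  have hn : (1 : ℝ) < (Module.finrank ℝ E : ℝ) := by exact_mod_cast hE
  refine ⟨(contDiff_japanesePrimitive hn).comp_contDiffOn (contDiffOn_sinhDist a e),
    fun x hx => ?_⟩
  set n : ℝ := (Module.finrank ℝ E : ℝ) with hn'
  have hφ : ∀ y : ℝ, HasDerivAt (fun t : ℝ => (1 + t ^ 2) ^ (-n / 2))
      (-n * y * (1 + y ^ 2) ^ (-n / 2 - 1)) y := by
    intro y
    have h1 : HasDerivAt (fun t : ℝ => 1 + t ^ 2) (2 * y) y := by
      simpa using (hasDerivAt_pow 2 y).const_add 1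
    refine (h1.rpow_const (p := -n / 2) (Or.inl (by positivity))).congr_deriv ?_
    ring
  have hgrad : ∀ y ∈ ball (0 : E) 1,
      HasFDerivAt (fun x => japanesePrimitive n (sinhDist a e x))
        (((1 + sinhDist a e y ^ 2) ^ (-n / 2) * (2 * (sinhDist a e y - a) * (1 - ‖y‖ ^ 2)⁻¹)) •
          innerSL ℝ y + ((1 + sinhDist a e y ^ 2) ^ (-n / 2) *
            (2 * √(1 + a ^ 2) * (1 - ‖y‖ ^ 2)⁻¹)) • innerSL ℝ e) y := by
    intro y hy
    refine ((hasDerivAt_japanesePrimitive hn _).comp_hasFDerivAt y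
      (hasFDerivAt_sinhDist a e hy)).congr_fderiv ?_
    rw [smul_add, smul_smul, smul_smul]
  have hw := hasFDerivAt_sinhDist a e hx
  have hD := hasFDerivAt_one_sub_norm_sq_inv hx
  have hφw := (hφ (sinhDist a e x)).comp_hasFDerivAt x hw
  have hΔ := laplacian_of_hasFDerivAt isOpen_ball hgrad hx
    (hφw.mul (((hw.sub_const a).const_mul 2).mul hD)) (hφw.mul (hD.const_mul (2 * √(1 + a ^ 2))))
  rw [hΔ, (hgrad x hx).fderiv]
  have hs := one_sub_norm_sq_pos hx
  have hDs : (1 - ‖x‖ ^ 2) * (1 - ‖x‖ ^ 2)⁻¹ = 1 := mul_inv_cancel₀ hs.ne'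
  have hν : √(1 + a ^ 2) ^ 2 = 1 + a ^ 2 := Real.sq_sqrt (by positivity)
  have hwdef : sinhDist a e x * (1 - ‖x‖ ^ 2) =
      2 * √(1 + a ^ 2) * ⟪e, x⟫_ℝ - a * (1 + ‖x‖ ^ 2) := by
    rw [sinhDist, mul_assoc, mul_comm _ (1 - ‖x‖ ^ 2), hDs, mul_one]
  have hΦ : (1 + sinhDist a e x ^ 2) ^ (-n / 2) =
      (1 + sinhDist a e x ^ 2) ^ (-n / 2 - 1) * (1 + sinhDist a e x ^ 2) := by
    have : (0 : ℝ) < 1 + sinhDist a e x ^ 2 := by positivity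
    rw [Real.rpow_sub_one this.ne', div_mul_cancel₀ _ this.ne']
  simp only [Function.comp_apply, _root_.add_apply, _root_.smul_apply, smul_eq_mul,
    innerSL_apply_apply, real_inner_self_eq_norm_sq, he, ← hn',
    real_inner_comm e x]
  rw [hΦ]
  clear hΦ hΔ hgrad hw hD hφw hφ
  generalize (1 + sinhDist a e x ^ 2) ^ (-n / 2 - 1) = Φ
  generalize sinhDist a e x = w at *
  generalize √(1 + a ^ 2) = ν at *
  generalize ⟪e, x⟫_ℝ = τ at *
  generalize (1 - ‖x‖ ^ 2)⁻¹ = D at *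
  generalize ‖x‖ ^ 2 = s at *
  -- The Euclidean radial derivative `x·∇w`, with `D = (1 - |x|²)⁻¹`.
  have hX : 2 * (w - a) * D * s + 2 * ν * D * τ = 2 * w * D - w + a := by
    linear_combination (a - w) * hDs - D * hwdef
  -- Multiplied by `2 D`, this reads `|∇w|² = 4 D² (1 + w²)` for the Euclidean gradient.
  have hQ : (w - a) * (2 * (w - a) * D * s + 2 * ν * D * τ) +
      ν * (2 * (w - a) * D * τ + 2 * ν * D) = 2 * (1 + w ^ 2) * D := by
    linear_combination (-2 * D * (w - a)) * hwdef + 2 * D * hν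
  linear_combination (2 * n * (Φ * (1 + w ^ 2)) * (w - a) +
    4 * (Φ * (1 + w ^ 2)) * (2 * (w - a) * D * s + 2 * ν * D * τ) -
    2 * n * w * Φ * ((w - a) * (2 * (w - a) * D * s + 2 * ν * D * τ) +
      ν * (2 * (w - a) * D * τ + 2 * ν * D))) * hDs - 2 * n * w * Φ * hQ +
    2 * n * (Φ * (1 + w ^ 2)) * hX

theorem exists_hyperbolicHarmonic_gradient_gt (hE : 2 ≤ Module.finrank ℝ E) {c : ℝ}
    (hc : c < (Module.finrank ℝ E : ℝ) - 1) {e : E} (he : ‖e‖ = 1) :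
    ∃ h : E → ℝ, IsWeightedHarmonic ((Module.finrank ℝ E : ℝ) - 2) h ∧
      MapsTo h (ball 0 1) (Ioo (-1) 1) ∧ c * (1 - |h 0| ^ 2) < ‖gradient h 0‖ := by
  set n : ℝ := (Module.finrank ℝ E : ℝ) with hn
  have hn1 : 1 < n := by rw [hn]; exact_mod_cast hE
  suffices H : ∀ c : ℝ, 0 < c → c < n - 1 →
      ∃ h : E → ℝ, IsWeightedHarmonic (n - 2) h ∧ MapsTo h (ball 0 1) (Ioo (-1) 1) ∧
        c * (1 - |h 0| ^ 2) < ‖gradient h 0‖ by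
    rcases lt_or_ge 0 c with h | h
    · exact H c h hc
    · obtain ⟨u, h1, h2, h3⟩ := H ((n - 1) / 2) (by linarith) (by linarith)
      refine ⟨u, h1, h2, lt_of_le_of_lt ?_ h3⟩
      have h4 := h2 (mem_ball_self one_pos : (0 : E) ∈ ball 0 1)
      refine mul_le_mul_of_nonneg_right (by linarith) ?_
      rw [sq_abs]
      nlinarith [h4.1, h4.2]
  clear hc c
  intro c hc0 hc
  -- Up to the factor `2 (n - 1)`, this is a lower bound for the logarithmic derivative at the
  -- origin of the extremal with parameter `a`; `a → ∞` moves the hyperplane to the boundary point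
  -- `e`.
  have hlim : Tendsto (fun a : ℝ => (1 + (a ^ 2)⁻¹) ^ ((1 - n) / 2)) atTop (𝓝 1) := by
    have h1 : Tendsto (fun a : ℝ => 1 + (a ^ 2)⁻¹) atTop (𝓝 (1 + 0)) :=
      tendsto_const_nhds.add (tendsto_inv_atTop_zero.comp (tendsto_pow_atTop two_ne_zero))
    rw [add_zero] at h1
    simpa using h1.rpow_const (p := (1 - n) / 2) (Or.inl one_ne_zero)
  have hc1 : c / (n - 1) < 1 := by rw [div_lt_one (by linarith)]; exact hc
  obtain ⟨a, ha, ha0⟩ := ((hlim.eventually (lt_mem_nhds hc1)).and (eventually_gt_atTop 0)).exists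
  have h0 : (0 : E) ∈ ball (0 : E) 1 := mem_ball_self one_pos
  refine (isWeightedHarmonic_japanesePrimitive_sinhDist hE a he).exists_gradient_gt (e := e)
    (B := ∫ t : ℝ, (1 + t ^ 2) ^ (-n / 2)) (fun x _ => japanesePrimitive_pos hn1 _)
    (fun x _ => japanesePrimitive_le hn1 _) he hc0 ?_
  have hw0 : sinhDist a e (0 : E) = -a := by simp [sinhDist]
  have hfd : fderiv ℝ (fun x => japanesePrimitive n (sinhDist a e x)) 0 e =
      2 * (√(1 + a ^ 2) * (1 + a ^ 2) ^ (-n / 2)) := by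
    have h := (hasDerivAt_japanesePrimitive hn1 _).comp_hasFDerivAt (0 : E)
      (hasFDerivAt_sinhDist a e h0)
    rw [show (fun x => japanesePrimitive n (sinhDist a e x)) =
      japanesePrimitive n ∘ sinhDist a e from rfl, h.fderiv]
    simp [hw0, he]
    ring
  have h1a : (0 : ℝ) < 1 + a ^ 2 := by positivity
  have h1 : √(1 + a ^ 2) * (1 + a ^ 2) ^ (-n / 2) = (1 + a ^ 2) ^ ((1 - n) / 2) := by
    rw [Real.sqrt_eq_rpow, ← Real.rpow_add h1a]
    congr 1
    ring
  have h2 : (1 + a ^ 2) ^ ((1 - n) / 2) = a ^ (1 - n) * (1 + (a ^ 2)⁻¹) ^ ((1 - n) / 2) := by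
    have h3 : a ^ (1 - n) = (a ^ 2) ^ ((1 - n) / 2) := by
      rw [← Real.rpow_natCast, ← Real.rpow_mul ha0.le]
      congr 1
      push_cast
      ring
    rw [h3, ← Real.mul_rpow (by positivity) (by positivity)]
    congr 1
    field_simp
    ring
  have h3 := japanesePrimitive_neg_le hn1 ha0
  rw [hfd, hw0, h1, h2]
  have h4 : 0 < a ^ (1 - n) := Real.rpow_pos_of_pos ha0 _
  have h5 := mul_le_mul_of_nonneg_left h3 hc0.le
  have h6 := mul_le_mul_of_nonneg_left ha.le h4.le
  have h7 : c * (a ^ (1 - n) / (n - 1)) = a ^ (1 - n) * (c / (n - 1)) := by ring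
  linarith

end HyperbolicExtremals

/-! ### Translation to the two equations of the theorem. -/

section MainTheorem

variable {E : Type*} [NormedAddCommGroup E] [InnerProductSpace ℝ E] [FiniteDimensional ℝ E]

/-- The norm of the gradient is a directional derivative along a unit vector. -/
theorem exists_norm_gradient_eq [Nontrivial E] (h : E → ℝ) (x : E) :
    ∃ e : E, ‖e‖ = 1 ∧ ‖gradient h x‖ = fderiv ℝ h x e := by
  have hg : ∀ v, fderiv ℝ h x v = ⟪gradient h x, v⟫_ℝ := fun v => by simp [gradient]
  by_cases h0 : gradient h x = 0
  · obtain ⟨e, he⟩ := exists_norm_eq E (zero_le_one' ℝ)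
    exact ⟨e, he, by rw [hg, h0]; simp⟩
  · have h1 : ‖gradient h x‖ ≠ 0 := by simpa using h0
    refine ⟨‖gradient h x‖⁻¹ • gradient h x, ?_, ?_⟩
    · rw [norm_smul, norm_inv, norm_norm, inv_mul_cancel₀ h1]
    · rw [hg, inner_smul_right, real_inner_self_eq_norm_sq]
      field_simp

variable {n : ℕ}

theorem isHarmonic_iff_isWeightedHarmonic {h : EuclideanSpace ℝ (Fin n) → ℝ} :
    IsHarmonic h ↔ IsWeightedHarmonic 0 h := by
  constructor
  · intro hh
    refine ⟨hh.contDiffOn, fun x hx => ?_⟩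
    rw [(hh x hx).2.self_of_nhds]
    simp
  · rintro ⟨h1, h2⟩ x hx
    refine ⟨h1.contDiffAt (isOpen_ball.mem_nhds hx), ?_⟩
    filter_upwards [isOpen_ball.mem_nhds hx] with y hy
    have h3 := h2 y hy
    rw [mul_zero, zero_mul, add_zero] at h3
    exact (mul_eq_zero.1 h3).resolve_left (one_sub_norm_sq_pos hy).ne'

theorem isHyperbolicHarmonic_iff_isWeightedHarmonic {h : EuclideanSpace ℝ (Fin n) → ℝ} :
    IsHyperbolicHarmonic h ↔ IsWeightedHarmonic ((n : ℝ) - 2) h := by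
  have key : ∀ x : EuclideanSpace ℝ (Fin n), hyperbolicLaplacian h x = (1 - ‖x‖ ^ 2) *
      ((1 - ‖x‖ ^ 2) * Laplacian.laplacian h x + 2 * ((n : ℝ) - 2) * fderiv ℝ h x x) := by
    intro x
    have h1 : ∑ i : Fin n, x i * fderiv ℝ h x (EuclideanSpace.single i (1 : ℝ)) =
        fderiv ℝ h x x := by
      have := congrArg (fderiv ℝ h x) ((EuclideanSpace.basisFun (Fin n) ℝ).sum_repr x)
      simpa only [map_sum, map_smul, smul_eq_mul, EuclideanSpace.basisFun_repr,
        EuclideanSpace.basisFun_apply] using this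
    rw [hyperbolicLaplacian, h1]
    ring
  refine and_congr Iff.rfl (forall₂_congr fun x hx => ?_)
  rw [key, mul_eq_zero, or_iff_right (one_sub_norm_sq_pos hx).ne']

end MainTheorem

theorem mainTheorem4 (n : ℕ) (hn : 3 ≤ n) :
    -- harmonic functions: the estimate, its strictness for `n ≥ 4`, and its sharpness
    ((∀ h : EuclideanSpace ℝ (Fin n) → ℝ, IsHarmonic h →
        Set.MapsTo h (unitBall n) (Set.Ioo (-1) 1) →
          ‖gradient h 0‖ ≤ (n : ℝ) / 2 * (1 - |h 0| ^ 2) ∧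
          (4 ≤ n → ‖gradient h 0‖ < (n : ℝ) / 2 * (1 - |h 0| ^ 2))) ∧
      (∀ c : ℝ, c < (n : ℝ) / 2 → ∃ h : EuclideanSpace ℝ (Fin n) → ℝ, IsHarmonic h ∧
        Set.MapsTo h (unitBall n) (Set.Ioo (-1) 1) ∧
          c * (1 - |h 0| ^ 2) < ‖gradient h 0‖)) ∧
    -- hyperbolic harmonic functions: the estimate, its strictness for `n ≥ 4`, and its sharpness
    ((∀ h : EuclideanSpace ℝ (Fin n) → ℝ, IsHyperbolicHarmonic h →
        Set.MapsTo h (unitBall n) (Set.Ioo (-1) 1) →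
          ‖gradient h 0‖ ≤ ((n : ℝ) - 1) * (1 - |h 0| ^ 2) ∧
          (4 ≤ n → ‖gradient h 0‖ < ((n : ℝ) - 1) * (1 - |h 0| ^ 2))) ∧
      (∀ c : ℝ, c < (n : ℝ) - 1 → ∃ h : EuclideanSpace ℝ (Fin n) → ℝ, IsHyperbolicHarmonic h ∧
        Set.MapsTo h (unitBall n) (Set.Ioo (-1) 1) ∧
          c * (1 - |h 0| ^ 2) < ‖gradient h 0‖)) := by
  have hfr : Module.finrank ℝ (EuclideanSpace ℝ (Fin n)) = n := finrank_euclideanSpace_fin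
  have hn' : (3 : ℝ) ≤ n := by exact_mod_cast hn
  have : Nontrivial (EuclideanSpace ℝ (Fin n)) :=
    Module.nontrivial_of_finrank_pos (R := ℝ) (by omega)
  obtain ⟨e₀, he₀⟩ := exists_norm_eq (EuclideanSpace ℝ (Fin n)) (zero_le_one' ℝ)
  refine ⟨⟨fun h hh hmaps => ?_, fun c hc => ?_⟩, ⟨fun h hh hmaps => ?_, fun c hc => ?_⟩⟩
  · rw [isHarmonic_iff_isWeightedHarmonic] at hh
    obtain ⟨e, he, hge⟩ := exists_norm_gradient_eq h 0
    obtain ⟨M, -, hM, hM1, hM2⟩ := hh.exists_first_moment_bound (by omega) hmaps he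
    have h1 := hh.fderiv_le_of_harmonic (by omega) e hM
    rw [hfr] at h1 hM2
    rw [hge]
    exact ⟨by nlinarith, fun h4 => by nlinarith [hM2 h4]⟩
  · obtain ⟨h, h1, h2, h3⟩ := exists_harmonic_gradient_gt (by omega) (by rwa [hfr]) he₀
    exact ⟨h, isHarmonic_iff_isWeightedHarmonic.2 h1, h2, h3⟩
  · rw [isHyperbolicHarmonic_iff_isWeightedHarmonic] at hh
    obtain ⟨e, he, hge⟩ := exists_norm_gradient_eq h 0
    obtain ⟨M, hM0, hM, hM1, hM2⟩ := hh.exists_first_moment_bound (by omega) hmaps he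
    have h1 := IsWeightedHarmonic.fderiv_le_of_hyperbolic (by rwa [hfr]) (by omega) e hM0 hM
    rw [hfr] at h1 hM2
    rw [hge]
    exact ⟨by nlinarith, fun h4 => by nlinarith [hM2 h4]⟩
  · obtain ⟨h, h1, h2, h3⟩ := exists_hyperbolicHarmonic_gradient_gt (by omega) (by rwa [hfr]) he₀
    rw [hfr] at h1
    exact ⟨h, isHyperbolicHarmonic_iff_isWeightedHarmonic.2 h1, h2, h3⟩
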